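/- Let $\Sigma$ be a totally ordered alphabet and let $x=x[1..n]=\#\,w\,\$$, where $w$ is any (possibly empty) word over $\Sigma$ and $\#,\$$ are two new letters with $\#>\$>a$ for all $a\in\Sigma$; so $n=|w|+2$. Let $x_i=x[i..n]$, let $\prec$ be the lexicographic order (a proper prefix is smaller), and let $\mathrm{lce}(i,j)$ be the length of the longest common prefix of $x_i$ and $x_j$ (and $0$ if $i=0$ or $j=n+1$). A non-empty word is *inverse Lyndon* if it is lexicographically greater than each of its non-empty proper suffixes. For $1\le i\le n$ put $$\lambda^{-1}[i]=\max\{m\in[1,n-i+1] : x[i..i+m-1]\text{ is inverse Lyndon}\},$$ $$\mathrm{next}_{-1}[i]=\min\big(\{j\in(i,n]: x_j\succ x_i\}\cup\{n+1\}\big),\qquad \mathrm{prev}_{-1}[i]=\max\big(\{j\in[1,i): x_j\succ x_i\}\cup\{0\}\big).$$ Algorithm LCE-NGS works with arrays $\mathrm{next},\mathrm{prev},\mathrm{nlce},\mathrm{plce},\lambda$ and with global numbers $\mathit{rhs}$ and $d$, as follows. * Set $\mathrm{prev}[1]=\mathrm{plce}[1]=\mathrm{nlce}[1]=\mathrm{nlce}[n]=0$,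 $\mathrm{next}[1]=\mathrm{next}[n]=n+1$, $\mathit{rhs}=d=0$. * For $r=2,\dots,n$: let $\ell=r-1$ and $m=\textsc{Smart-Lce}(\ell,r,0)$; while $x[\ell+m]<x[r+m]$, set $\mathrm{next}[\ell]=r$ and $\mathrm{nlce}[\ell]=m$, then replace $m$ by $\textsc{Smart-Lce}(\mathrm{prev}[\ell],r,m)$ if $m=\mathrm{plce}[\ell]$ and by $\mathrm{plce}[\ell]$ if $m>\mathrm{plce}[\ell]$, then replace $\ell$ by $\mathrm{prev}[\ell]$. After the while loop set $\mathrm{prev}[r]=\ell$, $\mathrm{plce}[r]=m$. * For $i=1,\dots,n$ set $\lambda[i]=\mathrm{next}[i]-i+\mathrm{nlce}[i]$. Here $\textsc{Smart-Lce}(q,r,m)$ does the following. If $r+m<\mathit{rhs}$, it replaces $m$ by $\mathrm{plce}[r-d]$ if $\mathrm{prev}[r-d]=q-d$, and by $\mathrm{nlce}[q-d]$ otherwise; if now $r+m<\mathit{rhs}$, it returns $m$, and otherwise it sets $m=\mathit{rhs}-r$ and goes on as in the next case. If $r+m\ge\mathit{rhs}$ at the call, it increases $m$ as long as $x[q+m]=x[r+m]$,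 then sets $\mathit{rhs}=r+m$, $d=r-q$ and returns $m$. **Theorem.** On a unit-cost RAM that can access the text only by order and equality comparisons of two of its letters, Algorithm LCE-NGS runs in $O(n)$ time and $O(n)$ space, the stored numbers also being $O(n)$, with constants that do not depend on $w$ or on the alphabet. It halts with, for all $1\le i\le n$, $\mathrm{next}[i]=\mathrm{next}_{-1}[i]$, $\mathrm{prev}[i]=\mathrm{prev}_{-1}[i]$, $\mathrm{nlce}[i]=\mathrm{lce}(i,\mathrm{next}_{-1}[i])$, $\mathrm{plce}[i]=\mathrm{lce}(\mathrm{prev}_{-1}[i],i)$ and $\lambda[i]=\lambda^{-1}[i]$; in particular it computes the inverse Lyndon array, and $\lambda^{-1}[i]=\mathrm{next}[i]-i+\mathrm{nlce}[i]$. -/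

import Mathlib

namespace InvLyndon

/-! ### Words, inverse Lyndon words and the arrays attached to a word

Words are lists, ordered by Mathlib's lexicographic order on lists (a proper prefix is smaller).
Positions are numbered from `1`. -/

section Words

variable {L : Type*} [LinearOrder L]

/-- The suffix `x_i = x[i..n]` that starts at position `i ≥ 1`; it is empty for `i > n`. -/
def suffixAt (x : List L) (i : ℕ) : List L := x.drop (i - 1)

/-- The subword `x[i..i+m-1]` of length `m` that starts at position `i` (for `i + m ≤ n + 1`). -/
def subword (x : List L) (i m : ℕ) : List L := (suffixAt x i).take m

/-- A nonempty word that is lexicographically greater than each of its nonempty proper suffixes. -/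
def IsInverseLyndon (w : List L) : Prop :=
  w ≠ [] ∧ ∀ s : List L, s <:+ w → s ≠ [] → s ≠ w → s < w

/-- The inverse Lyndon array: the largest `m` in `[1, n - i + 1]` such that `x[i..i+m-1]` is an
inverse Lyndon word. (For `1 ≤ i ≤ n` the set contains `1` and is bounded.) -/
noncomputable def invLyndonArray (x : List L) (i : ℕ) : ℕ :=
  sSup {m : ℕ | 1 ≤ m ∧ m ≤ x.length - i + 1 ∧ IsInverseLyndon (subword x i m)}

/-- The next greater suffix array: the least `j` in `(i, n]` with `x_j` greater than `x_i`, and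
`n + 1` if there is none. -/
noncomputable def nextGreater (x : List L) (i : ℕ) : ℕ :=
  sInf ({j : ℕ | i < j ∧ j ≤ x.length ∧ suffixAt x i < suffixAt x j} ∪ {x.length + 1})

/-- The previous greater suffix array: the largest `j` in `[1, i)` with `x_j` greater than `x_i`,
and `0` if there is none. -/
noncomputable def prevGreater (x : List L) (i : ℕ) : ℕ :=
  sSup ({j : ℕ | 1 ≤ j ∧ j < i ∧ suffixAt x i < suffixAt x j} ∪ {0})

/-- The length of the longest common prefix of the suffixes `x_i` and `x_j`, for `i, j ≥ 1`; as a
convention it is `0` if `i = 0` or `j = 0`. -/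
noncomputable def lce (x : List L) (i j : ℕ) : ℕ :=
  if i = 0 ∨ j = 0 then 0
  else sSup {k : ℕ | ∃ u : List L, u <+: suffixAt x i ∧ u <+: suffixAt x j ∧ u.length = k}

end Words

/-- The framed word `# w $` over the alphabet of `w` enlarged by two new letters `#` (the outer
`⊤`) and `$` (the inner `⊤`), which satisfy `# > $ > a` for every letter `a` of `w`. -/
def frame {α : Type*} (w : List α) : List (WithTop (WithTop α)) :=
  (⊤ : WithTop (WithTop α)) ::
    (w.map (fun a => ((a : WithTop α) : WithTop (WithTop α))) ++
      [((⊤ : WithTop α) : WithTop (WithTop α))])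

/-! ### A unit-cost comparison RAM

Programs work on finitely many registers (indexed by `V`) and finitely many arrays (indexed by
`A`), all of which hold natural numbers. The letters of the input text cannot be stored or turned
into numbers; a program can only ask whether one letter of the text is smaller than, or equal to,
another one. -/

section Machine

variable {V A L : Type*}

/-- Arithmetic expressions: constants, registers, array reads, addition, truncated subtraction. -/
inductive Expr (V A : Type*) where
  | num (k : ℕ)
  | var (v : V)
  | get (a : A) (e : Expr V A)
  | add (e f : Expr V A)
  | sub (e f : Expr V A)

/-- Tests: comparison of two numbers, or of the letters at two positions of the text. -/
inductive Test (V A : Type*) where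
  | numLt (e f : Expr V A)
  | numEq (e f : Expr V A)
  | letterLt (e f : Expr V A)
  | letterEq (e f : Expr V A)

/-- Programs. -/
inductive Stmt (V A : Type*) where
  | skip
  | assign (v : V) (e : Expr V A)
  | store (a : A) (i e : Expr V A)
  | seq (s t : Stmt V A)
  | branch (c : Test V A) (s t : Stmt V A)
  | loop (c : Test V A) (s : Stmt V A)

infixr:60 " ;; " => Stmt.seq

/-- The contents of the registers and of the arrays. -/
structure State (V A : Type*) where
  reg : V → ℕ
  arr : A → ℕ → ℕ

/-- The resources of a machine: its read-only text, the common length of its arrays, and the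
largest number that it can compute or store. -/
structure Machine (L : Type*) where
  text : List L
  arrLen : ℕ
  maxWord : ℕ

/-- The number of memory cells: one for each register, `arrLen` for each array. -/
def Machine.cells (V A : Type*) [Fintype V] [Fintype A] (M : Machine L) : ℕ :=
  Fintype.card V + Fintype.card A * M.arrLen

/-- The letter at position `p`, if `1 ≤ p ≤ n`. -/
def Machine.letter (M : Machine L) (p : ℕ) : Option L :=
  if p = 0 then none else M.text[p - 1]?

/-- A computed number, if it fits into a machine word. -/
def Machine.word (M : Machine L) (k : ℕ) : Option ℕ :=
  if k ≤ M.maxWord then some k else none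

/-- The content of cell `k` of array `a`, if the machine has that cell. -/
def Machine.read (M : Machine L) (σ : State V A) (a : A) (k : ℕ) : Option ℕ :=
  if k < M.arrLen then some (σ.arr a k) else none

/-- The value of an expression; `none` if a resource of the machine is exceeded. -/
def Expr.eval (M : Machine L) (σ : State V A) : Expr V A → Option ℕ
  | .num k => M.word k
  | .var v => some (σ.reg v)
  | .get a e => (e.eval M σ).bind (M.read σ a)
  | .add e f => (e.eval M σ).bind fun x => (f.eval M σ).bind fun y => M.word (x + y)
  | .sub e f => (e.eval M σ).bind fun x => (f.eval M σ).bind fun y => M.word (x - y)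

/-- The time to evaluate an expression: one unit for each operation and each operand. -/
def Expr.cost : Expr V A → ℕ
  | .num _ => 1
  | .var _ => 1
  | .get _ e => e.cost + 1
  | .add e f => e.cost + f.cost + 1
  | .sub e f => e.cost + f.cost + 1

/-- The outcome of a test; `none` if a resource of the machine is exceeded or a position outside
the text is inspected. -/
def Test.eval [LinearOrder L] (M : Machine L) (σ : State V A) : Test V A → Option Bool
  | .numLt e f => (e.eval M σ).bind fun x => (f.eval M σ).bind fun y => some (decide (x < y))
  | .numEq e f => (e.eval M σ).bind fun x => (f.eval M σ).bind fun y => some (decide (x = y))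
  | .letterLt e f => ((e.eval M σ).bind M.letter).bind fun a =>
      ((f.eval M σ).bind M.letter).bind fun b => some (decide (a < b))
  | .letterEq e f => ((e.eval M σ).bind M.letter).bind fun a =>
      ((f.eval M σ).bind M.letter).bind fun b => some (decide (a = b))

/-- The time of a test. -/
def Test.cost : Test V A → ℕ
  | .numLt e f => e.cost + f.cost + 1
  | .numEq e f => e.cost + f.cost + 1
  | .letterLt e f => e.cost + f.cost + 1
  | .letterEq e f => e.cost + f.cost + 1

/-- Write `k` into register `v`. -/
def State.setReg [DecidableEq V] (σ : State V A) (v : V) (k : ℕ) : State V A :=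
  { σ with reg := Function.update σ.reg v k }

/-- Write `k` into cell `p` of array `a`. -/
def State.setArr [DecidableEq A] (σ : State V A) (a : A) (p k : ℕ) : State V A :=
  { σ with arr := Function.update σ.arr a (Function.update (σ.arr a) p k) }

/-- `Exec M s σ t σ'`: on the machine `M`, the program `s` started in `σ` never exceeds the
resources of `M` and halts in `σ'` after `t` units of time. -/
inductive Exec [DecidableEq V] [DecidableEq A] [LinearOrder L] (M : Machine L) :
    Stmt V A → State V A → ℕ → State V A → Prop
  | skip (σ : State V A) : Exec M .skip σ 1 σ
  | assign (σ : State V A) (v : V) (e : Expr V A) (k : ℕ) (he : e.eval M σ = some k) :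
      Exec M (.assign v e) σ (e.cost + 1) (σ.setReg v k)
  | store (σ : State V A) (a : A) (i e : Expr V A) (p k : ℕ) (hi : i.eval M σ = some p)
      (hp : p < M.arrLen) (he : e.eval M σ = some k) :
      Exec M (.store a i e) σ (i.cost + e.cost + 1) (σ.setArr a p k)
  | seq {s s' : Stmt V A} {σ σ' σ'' : State V A} {t t' : ℕ} (h : Exec M s σ t σ')
      (h' : Exec M s' σ' t' σ'') : Exec M (s ;; s') σ (t + t') σ''
  | branch_true {c : Test V A} {s s' : Stmt V A} {σ σ' : State V A} {t : ℕ}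
      (hc : c.eval M σ = some true) (h : Exec M s σ t σ') :
      Exec M (.branch c s s') σ (c.cost + t + 1) σ'
  | branch_false {c : Test V A} {s s' : Stmt V A} {σ σ' : State V A} {t : ℕ}
      (hc : c.eval M σ = some false) (h : Exec M s' σ t σ') :
      Exec M (.branch c s s') σ (c.cost + t + 1) σ'
  | loop_false {c : Test V A} {s : Stmt V A} {σ : State V A} (hc : c.eval M σ = some false) :
      Exec M (.loop c s) σ (c.cost + 1) σ
  | loop_true {c : Test V A} {s : Stmt V A} {σ σ' σ'' : State V A} {t t' : ℕ}
      (hc : c.eval M σ = some true) (h : Exec M s σ t σ') (h' : Exec M (.loop c s) σ' t' σ'') :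
      Exec M (.loop c s) σ (c.cost + t + t' + 1) σ''

/-- Executions are deterministic: the running time and the final state are unique. -/
theorem Exec.unique [DecidableEq V] [DecidableEq A] [LinearOrder L] {M : Machine L}
    {s : Stmt V A} {σ σ₁ σ₂ : State V A} {t₁ t₂ : ℕ} (h₁ : Exec M s σ t₁ σ₁)
    (h₂ : Exec M s σ t₂ σ₂) : t₁ = t₂ ∧ σ₁ = σ₂ := by
  induction h₁ generalizing t₂ σ₂ with
  | skip σ => cases h₂; exact ⟨rfl, rfl⟩
  | assign σ v e k he => cases h₂; simp_all
  | store σ a i e p k hi hp he => cases h₂; simp_all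
  | seq _ _ ih ih' =>
    cases h₂ with
    | seq g g' =>
      obtain ⟨rfl, rfl⟩ := ih g
      obtain ⟨rfl, rfl⟩ := ih' g'
      exact ⟨rfl, rfl⟩
  | branch_true hc _ ih =>
    cases h₂ with
    | branch_true _ g => obtain ⟨rfl, rfl⟩ := ih g; exact ⟨rfl, rfl⟩
    | branch_false gc _ => simp_all
  | branch_false hc _ ih =>
    cases h₂ with
    | branch_true gc _ => simp_all
    | branch_false _ g => obtain ⟨rfl, rfl⟩ := ih g; exact ⟨rfl, rfl⟩
  | loop_false hc =>
    cases h₂ with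
    | loop_false _ => exact ⟨rfl, rfl⟩
    | loop_true gc _ _ => simp_all
  | loop_true hc _ _ ih ih' =>
    cases h₂ with
    | loop_false gc => simp_all
    | loop_true _ g g' =>
      obtain ⟨rfl, rfl⟩ := ih g
      obtain ⟨rfl, rfl⟩ := ih' g'
      exact ⟨rfl, rfl⟩

end Machine

/-! ### The algorithm LCE-NGS -/

/-- The registers: the length `n` of the text, the positions `l`, `r`, `i`, the current LCE value
`m`, the left position `q` of the current LCE query, and the certified window, which ends just
before position `rhs` and is a copy of the factor `dist` positions to its left. -/
inductive Reg where
  | n | l | r | m | q | rhs | dist | i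
  deriving DecidableEq

instance : Fintype Reg where
  elems := {.n, .l, .r, .m, .q, .rhs, .dist, .i}
  complete := by intro v; cases v <;> simp

/-- The arrays of the algorithm; all of them are outputs. -/
inductive Arr where
  | next | prev | nlce | plce | lam
  deriving DecidableEq

instance : Fintype Arr where
  elems := {.next, .prev, .nlce, .plce, .lam}
  complete := by intro a; cases a <;> simp

/-- Explicit scan: extend `m` letter by letter to the LCE of `q` and `r`, and record the window. -/
def extend : Stmt Reg Arr :=
  .loop (.letterEq (.add (.var .q) (.var .m)) (.add (.var .r) (.var .m)))
    (.assign .m (.add (.var .m) (.num 1))) ;;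
  .assign .rhs (.add (.var .r) (.var .m)) ;;
  .assign .dist (.sub (.var .r) (.var .q))

/-- `m ← Smart-Lce(q, r, m)`. If `r + m < rhs`, copy the value that is stored for the edge between
`q - dist` and `r - dist`, and scan only if this value reaches the end of the window; otherwise
scan at once. -/
def smartLce : Stmt Reg Arr :=
  .branch (.numLt (.add (.var .r) (.var .m)) (.var .rhs))
    (.branch (.numEq (.get .prev (.sub (.var .r) (.var .dist))) (.sub (.var .q) (.var .dist)))
        (.assign .m (.get .plce (.sub (.var .r) (.var .dist))))
        (.assign .m (.get .nlce (.sub (.var .q) (.var .dist)))) ;;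
      .branch (.numLt (.add (.var .r) (.var .m)) (.var .rhs))
        .skip
        (.assign .m (.sub (.var .rhs) (.var .r)) ;; extend))
    extend

/-- Boundary values and the empty initial window. -/
def setup : Stmt Reg Arr :=
  .store .prev (.num 1) (.num 0) ;;
  .store .plce (.num 1) (.num 0) ;;
  .store .next (.num 1) (.add (.var .n) (.num 1)) ;;
  .store .nlce (.num 1) (.num 0) ;;
  .store .next (.var .n) (.add (.var .n) (.num 1)) ;;
  .store .nlce (.var .n) (.num 0) ;;
  .assign .rhs (.num 0) ;;
  .assign .dist (.num 0)

/-- The inner loop: while `x[l + m] < x[r + m]`, the next greater suffix of `l` is `r`; then move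
to the previous greater suffix of `l`. -/
def climb : Stmt Reg Arr :=
  .loop (.letterLt (.add (.var .l) (.var .m)) (.add (.var .r) (.var .m)))
    (.store .next (.var .l) (.var .r) ;;
      .store .nlce (.var .l) (.var .m) ;;
      .branch (.numEq (.var .m) (.get .plce (.var .l)))
        (.assign .q (.get .prev (.var .l)) ;; smartLce)
        (.branch (.numLt (.get .plce (.var .l)) (.var .m))
          (.assign .m (.get .plce (.var .l)))
          .skip) ;;
      .assign .l (.get .prev (.var .l)))

/-- The outer loop, for `r = 2, …, n`. -/
def sweep : Stmt Reg Arr :=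
  .assign .r (.num 2) ;;
  .loop (.numLt (.var .r) (.add (.var .n) (.num 1)))
    (.assign .l (.sub (.var .r) (.num 1)) ;;
      .assign .q (.var .l) ;;
      .assign .m (.num 0) ;;
      smartLce ;;
      climb ;;
      .store .prev (.var .r) (.var .l) ;;
      .store .plce (.var .r) (.var .m) ;;
      .assign .r (.add (.var .r) (.num 1)))

/-- The recovery loop `lam[i] ← next[i] - i + nlce[i]`, for `i = 1, …, n`. -/
def recover : Stmt Reg Arr :=
  .assign .i (.num 1) ;;
  .loop (.numLt (.var .i) (.add (.var .n) (.num 1)))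
    (.store .lam (.var .i)
        (.add (.sub (.get .next (.var .i)) (.var .i)) (.get .nlce (.var .i))) ;;
      .assign .i (.add (.var .i) (.num 1)))

/-- Algorithm LCE-NGS. -/
def lceNGS : Stmt Reg Arr :=
  setup ;; sweep ;; recover

end InvLyndon

open InvLyndon

namespace InvLyndon

/-! ### Comparing the suffixes of a text given by its letters `f p`, `p ≥ 1` -/

section Order

variable {L : Type*} {f : ℕ → L} {n : ℕ}

/-! The last letter occurs nowhere else, so two different suffixes differ at a letter inside the
text, and the order on suffixes is decided at a first mismatch (`Framed.agree_le`,
`Framed.less_total`).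

Fix r. The positions whose next greater suffix is r, and the previous greater suffix of r, all lie
on the chain r - 1, prev[r - 1], ..., because whatever lies between two consecutive members is
smaller than the right one of them. In moving from l to l' = prev[l], with m = lce(l, r) and p =
plce[l], the new LCE is min(m, p) if m and p differ; only m = p needs a query.

Inside a window, the text repeats itself at distance d = r' - q'. If the suffixes between q and r
are smaller than both, the same holds for q - d and r - d, so these two are joined by a previous or
a next edge whose LCE is stored (`Window.copy`). The shift needs r' ≤ q. Otherwise r would exceed r'
at a mismatch inside the window; but no suffix after q' exceeds q' there, and r' reads like q'
(`Window.le_of_prevEdge`, `Window.not_ltAt_left`).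

The time is amortized: a matching comparison advances `rhs`, a climbing step lowers the depth of l
in the forest of previous greater suffixes, and each pass adds one new edge.

Finally, let k be the next greater suffix of i and e their LCE. Each proper suffix of x[i..k+e-1] is
a prefix of this word or smaller at a mismatch, while one more letter makes the suffix from k
greater (`agree_or_ltAt`, `invLyndonArray_eq`). -/

/-- The subwords of length `k` at the positions `i` and `j` are equal. -/
def Agree (f : ℕ → L) (i j k : ℕ) : Prop := ∀ t < k, f (i + t) = f (j + t)

theorem Agree.mono {i j k k' : ℕ} (h : Agree f i j k) (hk : k' ≤ k) : Agree f i j k' :=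
  fun t ht => h t (by omega)

theorem Agree.symm {i j k : ℕ} (h : Agree f i j k) : Agree f j i k := fun t ht => (h t ht).symm

theorem Agree.trans {a b c k : ℕ} (h : Agree f a b k) (h' : Agree f b c k) : Agree f a c k :=
  fun t ht => (h t ht).trans (h' t ht)

theorem Agree.zero {i j : ℕ} : Agree f i j 0 := fun t ht => by omega

theorem Agree.succ {i j k : ℕ} (h : Agree f i j k) (h' : f (i + k) = f (j + k)) :
    Agree f i j (k + 1) := by
  intro t ht
  rcases Nat.lt_succ_iff_lt_or_eq.1 ht with h1 | rfl
  · exact h t h1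
  · exact h'

theorem Agree.le_of_ne {i j k e : ℕ} (h : Agree f i j k) (h' : f (i + e) ≠ f (j + e)) : k ≤ e := by
  by_contra hc
  exact h' (h e (by omega))

variable [LinearOrder L]

/-- The suffixes at `i` and `j` agree on `e` letters, and then the one at `i` has the smaller
letter. -/
def LtAt (f : ℕ → L) (i j e : ℕ) : Prop := Agree f i j e ∧ f (i + e) < f (j + e)

/-- The suffix at `i` is smaller than the one at `j`, at a mismatch. -/
def Less (f : ℕ → L) (i j : ℕ) : Prop := ∃ e, LtAt f i j e

/-- `p` is the previous greater suffix of `i`, and `e` is their LCE. -/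
def PrevEdge (f : ℕ → L) (p i e : ℕ) : Prop :=
  1 ≤ p ∧ p < i ∧ LtAt f i p e ∧ ∀ j, p < j → j < i → Less f j i

/-- `k` is the next greater suffix of `i`, and `e` is their LCE. -/
def NextEdge (f : ℕ → L) (i k e : ℕ) : Prop :=
  i < k ∧ LtAt f i k e ∧ ∀ j, i < j → j < k → Less f j i

/-- The first letter is the greatest one, and the last letter is the second greatest one. -/
structure Framed (f : ℕ → L) (n : ℕ) : Prop where
  two_le : 2 ≤ n
  lt_first : ∀ p, 1 < p → p ≤ n → f p < f 1
  lt_last : ∀ p, 1 < p → p < n → f p < f n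

theorem LtAt.eq_of_ltAt {i j e e' : ℕ} (h : LtAt f i j e) (h' : LtAt f i j e') : e = e' :=
  le_antisymm (h.1.le_of_ne h'.2.ne) (h'.1.le_of_ne h.2.ne)

theorem LtAt.asymm {i j e e' : ℕ} (h : LtAt f i j e) (h' : LtAt f j i e') : False := by
  have he : e = e' := le_antisymm (h.1.le_of_ne h'.2.ne') (h'.1.le_of_ne h.2.ne')
  subst he
  exact lt_asymm h.2 h'.2

theorem Less.asymm {i j : ℕ} (h : Less f i j) (h' : Less f j i) : False := by
  obtain ⟨e, h⟩ := h
  obtain ⟨e', h'⟩ := h'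
  exact h.asymm h'

theorem Less.ne {i j : ℕ} (h : Less f i j) : i ≠ j := by
  rintro rfl
  exact h.asymm h

/-- The exact offset min e e' matters: it shows that derived comparisons are still decided within
the known prefix of a query. -/
theorem LtAt.trans {a b c e e' : ℕ} (h : LtAt f a b e) (h' : LtAt f b c e') :
    LtAt f a c (min e e') := by
  refine ⟨(h.1.mono (min_le_left _ _)).trans (h'.1.mono (min_le_right _ _)), ?_⟩
  rcases lt_trichotomy e e' with hlt | rfl | hlt
  · rw [min_eq_left hlt.le, ← h'.1 e hlt]; exact h.2
  · rw [min_self]; exact h.2.trans h'.2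
  · rw [min_eq_right hlt.le, h.1 e' hlt]; exact h'.2

theorem Less.trans {a b c : ℕ} (h : Less f a b) (h' : Less f b c) : Less f a c := by
  obtain ⟨e, h⟩ := h
  obtain ⟨e', h'⟩ := h'
  exact ⟨_, h.trans h'⟩

/-- A comparison decided at offset e reads only e + 1 letters. This moves comparisons into and out
of a window. -/
theorem LtAt.transfer {i j i' j' e k : ℕ} (h : LtAt f i j e) (hk : e < k) (hi : Agree f i' i k)
    (hj : Agree f j' j k) : LtAt f i' j' e := by
  refine ⟨((hi.mono hk.le).trans h.1).trans (hj.mono hk.le).symm, ?_⟩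
  rw [hi e hk, hj e hk]
  exact h.2

/-! ### Consequences of the two sentinels. -/

namespace Framed

theorem ne_last (hf : Framed f n) {p : ℕ} (h1 : 1 ≤ p) (hp : p < n) : f p ≠ f n := by
  have := hf.two_le
  rcases Nat.lt_or_ge 1 p with h | h
  · exact (hf.lt_last p h hp).ne
  · obtain rfl : p = 1 := by omega
    exact (hf.lt_first n (by omega) le_rfl).ne'

/-- At offset n - j the suffix at j reads the last letter, which the suffix at i cannot match. Hence
scans never leave the text. -/
theorem agree_le (hf : Framed f n) {i j k : ℕ} (hi : 1 ≤ i) (hij : i < j) (hj : j ≤ n)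
    (h : Agree f i j k) : j + k ≤ n := by
  have := h.le_of_ne (e := n - j) (by
    rw [show j + (n - j) = n by omega]
    exact hf.ne_last (by omega) (by omega))
  omega

theorem exists_ltAt (hf : Framed f n) {i j : ℕ} (hi : 1 ≤ i) (hij : i < j) (hj : j ≤ n) :
    ∃ e, LtAt f i j e ∨ LtAt f j i e := by
  have hex : ∃ e, f (i + e) ≠ f (j + e) := ⟨n - j, by
    rw [show j + (n - j) = n by omega]
    exact hf.ne_last (by omega) (by omega)⟩
  classical
  refine ⟨Nat.find hex, ?_⟩
  have hag : Agree f i j (Nat.find hex) := fun t ht => not_not.1 (Nat.find_min hex ht)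
  rcases lt_or_gt_of_ne (Nat.find_spec hex) with h | h
  · exact Or.inl ⟨hag, h⟩
  · exact Or.inr ⟨hag.symm, h⟩

theorem less_total (hf : Framed f n) {i j : ℕ} (hi : 1 ≤ i) (hj : 1 ≤ j) (hi' : i ≤ n)
    (hj' : j ≤ n) (hne : i ≠ j) : Less f i j ∨ Less f j i := by
  rcases lt_or_gt_of_ne hne with h | h
  · obtain ⟨e, he | he⟩ := hf.exists_ltAt hi h hj'
    exacts [Or.inl ⟨e, he⟩, Or.inr ⟨e, he⟩]
  · obtain ⟨e, he | he⟩ := hf.exists_ltAt hj h hi'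
    exacts [Or.inr ⟨e, he⟩, Or.inl ⟨e, he⟩]

theorem less_first (hf : Framed f n) {i : ℕ} (hi : 1 < i) (hin : i ≤ n) : Less f i 1 :=
  ⟨0, Agree.zero, hf.lt_first i hi hin⟩

theorem less_last (hf : Framed f n) {i : ℕ} (hi : 1 < i) (hin : i < n) : Less f i n :=
  ⟨0, Agree.zero, hf.lt_last i hi hin⟩

/-- The last position is always a candidate. Positions 1 and n have no greater suffix to their right
and are treated by `Boundary`. -/
theorem exists_nextEdge (hf : Framed f n) {i : ℕ} (hi : 1 < i) (hin : i < n) :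
    ∃ k e, k ≤ n ∧ NextEdge f i k e := by
  classical
  have hex : ∃ k, i < k ∧ k ≤ n ∧ Less f i k := ⟨n, hin, le_rfl, hf.less_last hi hin⟩
  obtain ⟨h1, h2, e, h3⟩ := Nat.find_spec hex
  refine ⟨Nat.find hex, e, h2, h1, h3, fun j hj hjk => ?_⟩
  rcases hf.less_total (i := i) (j := j) (by omega) (by omega) (by omega) (by omega) (by omega)
    with h | h
  · exact absurd ⟨hj, by omega, h⟩ (Nat.find_min hex hjk)
  · exact h

end Framed

theorem PrevEdge.eq_of_prevEdge {p p' i e e' : ℕ} (h : PrevEdge f p i e)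
    (h' : PrevEdge f p' i e') : p = p' ∧ e = e' := by
  obtain rfl : p = p' := by
    rcases lt_trichotomy p p' with hlt | heq | hlt
    · exact ((h.2.2.2 p' hlt h'.2.1).asymm ⟨_, h'.2.2.1⟩).elim
    · exact heq
    · exact ((h'.2.2.2 p hlt h.2.1).asymm ⟨_, h.2.2.1⟩).elim
  exact ⟨rfl, h.2.2.1.eq_of_ltAt h'.2.2.1⟩

/-! ### Depth in the forest of previous greater suffixes. -/

open Classical in
/-- The number of previous-greater-suffix steps that can be made from `i`. -/
noncomputable def depth (f : ℕ → L) (i : ℕ) : ℕ :=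
  if h : ∃ p e, PrevEdge f p i e then depth f h.choose + 1 else 0
termination_by i
decreasing_by
  obtain ⟨e, he⟩ := h.choose_spec
  exact he.2.1

/-- Previous edges are unique, so the choice made in `depth` is immaterial. -/
theorem PrevEdge.depth_eq {p i e : ℕ} (h : PrevEdge f p i e) : depth f i = depth f p + 1 := by
  have hex : ∃ p e, PrevEdge f p i e := ⟨p, e, h⟩
  obtain ⟨e', he'⟩ := hex.choose_spec
  rw [depth, dif_pos hex, (h.eq_of_prevEdge he').1]

/-! ### Windows and the copying of LCE values. -/

/-- `[r', rhs)` is a copy of the subword that starts at `q'`, and `q'` is greater than all suffixes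
between `q'` and `r'`. -/
structure Window (f : ℕ → L) (q' r' rhs : ℕ) : Prop where
  pos : 1 ≤ q'
  lt : q' < r'
  agree : Agree f q' r' (rhs - r')
  less : ∀ j, q' < j → j < r' → Less f j q'

theorem Window.agree_sub {q' r' rhs j : ℕ} (h : Window f q' r' rhs) (hj : r' ≤ j) :
    Agree f (j - (r' - q')) j (rhs - j) := by
  have := h.lt
  intro t ht
  have := h.agree (j - r' + t) (by omega)
  rwa [show q' + (j - r' + t) = j - (r' - q') + t by omega,
    show r' + (j - r' + t) = j + t by omega] at this

/-- No suffix that starts after `q'` exceeds the one at `q'` by a mismatch inside the window. -/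
theorem Window.not_ltAt_left {q' r' rhs : ℕ} (h : Window f q' r' rhs) (s : ℕ) :
    ∀ e, q' < s → s + e < rhs → ¬ LtAt f q' s e := by
  induction s using Nat.strong_induction_on with
  | _ s ih =>
    intro e hs he hlt
    have hqr := h.lt
    rcases lt_trichotomy s r' with hsr | rfl | hsr
    · exact (h.less s hs hsr).asymm ⟨e, hlt⟩
    · exact hlt.2.ne (h.agree e (by omega))
    -- Past r', the start s can be moved back by one period: the comparison reads only letters
    -- before rhs.
    · refine ih (s - (r' - q')) (by omega) e (by omega) (by omega) ?_
      exact hlt.transfer (k := rhs - s) (by omega) (fun _ _ => rfl) (h.agree_sub hsr.le)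

/-- Up to rhs the suffix at r' reads like the one at q', so it inherits the maximality of q'. -/
theorem Window.not_ltAt_right {q' r' rhs r e : ℕ} (h : Window f q' r' rhs) (hr : r' < r)
    (he : r + e < rhs) : ¬ LtAt f r' r e := fun hlt => by
  have hqr := h.lt
  refine h.not_ltAt_left r e (by omega) he ?_
  exact hlt.transfer (k := rhs - r) (by omega) (h.agree.mono (by omega)) (fun _ _ => rfl)

/-- A query for the previous greater suffix `q` of `l` whose known prefix ends inside the window
stays inside the window. -/
theorem Window.le_of_prevEdge {q' r' rhs q l r m : ℕ} (h : Window f q' r' rhs) (hr : r' < r)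
    (hm : r + m < rhs) (hlr : l < r) (hq : PrevEdge f q l m) (hl : LtAt f l r m)
    (hless : ∀ j, l < j → j < r → Less f j l) : r' ≤ q := by
  by_contra hlt
  -- If q were left of r', the suffix at r' would be at most the one at l or smaller than it, hence
  -- below r at an offset not exceeding m.
  have key : ∃ e, e ≤ m ∧ LtAt f r' r e := by
    have aux : Less f r' l → ∃ e, e ≤ m ∧ LtAt f r' r e := fun ⟨e, he⟩ =>
      ⟨_, min_le_right _ _, he.trans hl⟩
    rcases lt_trichotomy r' l with h1 | rfl | h1
    · exact aux (hq.2.2.2 r' (by omega) h1)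
    · exact ⟨m, le_rfl, hl⟩
    · exact aux (hless r' h1 hr)
  obtain ⟨e, hem, he⟩ := key
  exact h.not_ltAt_right hr (by omega) he

/-- The edges of the suffixes before `r`, as the arrays store them. -/
structure Stored (f : ℕ → L) (prev plce next nlce : ℕ → ℕ) (r : ℕ) : Prop where
  prev : ∀ i, 2 ≤ i → i < r → PrevEdge f (prev i) i (plce i)
  next : ∀ i k e, 1 ≤ i → k < r → NextEdge f i k e → next i = k ∧ nlce i = e

/-- The value that is copied for the query `(q, r)` is the LCE of `q` and `r`, unless it reaches the
end of the window. -/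
theorem Window.copy (hf : Framed f n) {q' r' rhs q r m : ℕ} {prev plce next nlce : ℕ → ℕ}
    (h : Window f q' r' rhs) (hs : Stored f prev plce next nlce r) (hq : r' ≤ q) (hqr : q < r)
    (hrn : r ≤ n) (hm : r + m < rhs)
    (hleft : ∀ j, q < j → j < r → ∃ e, e ≤ m ∧ LtAt f j q e)
    (hright : ∀ j, q < j → j < r → ∃ e, e ≤ m ∧ LtAt f j r e) {v : ℕ}
    (hv : v = if prev (r - (r' - q')) = q - (r' - q') then plce (r - (r' - q'))
      else nlce (q - (r' - q'))) :
    (r + v < rhs → LtAt f q r v ∨ LtAt f r q v) ∧ (rhs ≤ r + v → Agree f q r (rhs - r)) ∧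
      v ≤ n := by
  have hlt := h.lt
  have hpos := h.pos
  set d := r' - q' with hd
  have hag : ∀ j, r' ≤ j → Agree f (j - d) j (rhs - j) := fun j => h.agree_sub
  -- The bound e ≤ m keeps these comparisons before rhs, so they survive the shift by d.
  have hback : ∀ i j e, r' ≤ i → r' ≤ j → i ≤ r → j ≤ r → e ≤ m → LtAt f i j e →
      LtAt f (i - d) (j - d) e := fun i j e hi hj hir hjr he hl =>
    hl.transfer (k := rhs - r) (by omega) ((hag i hi).mono (by omega))
      ((hag j hj).mono (by omega))
  have hleft' : ∀ j, q - d < j → j < r - d → Less f j (q - d) := fun j h1 h2 => by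
    obtain ⟨e, he, hl⟩ := hleft (j + d) (by omega) (by omega)
    have := hback _ _ _ (by omega) hq (by omega) hqr.le he hl
    rw [Nat.add_sub_cancel] at this
    exact ⟨e, this⟩
  have hright' : ∀ j, q - d < j → j < r - d → Less f j (r - d) := fun j h1 h2 => by
    obtain ⟨e, he, hl⟩ := hright (j + d) (by omega) (by omega)
    have := hback _ _ _ (by omega) (by omega) (by omega) le_rfl he hl
    rw [Nat.add_sub_cancel] at this
    exact ⟨e, this⟩
  have hqd := hag q hq
  have hrd := hag r (by omega)
  -- Only smaller suffixes lie between q - d and r - d, so they form a next or a previous edge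
  -- according to which one is greater; the test on `prev` distinguishes the two.
  have main : LtAt f (q - d) (r - d) v ∨ LtAt f (r - d) (q - d) v := by
    obtain ⟨e, he | he⟩ := hf.exists_ltAt (i := q - d) (j := r - d) (by omega) (by omega)
      (by omega)
    · have hne : prev (r - d) ≠ q - d := fun heq => by
        have := (hs.prev (r - d) (by omega) (by omega)).2.2.1
        rw [heq] at this
        exact he.asymm this
      rw [if_neg hne, (hs.next (q - d) (r - d) e (by omega) (by omega)
        ⟨by omega, he, hleft'⟩).2] at hv
      exact Or.inl (hv ▸ he)
    · obtain ⟨h1, h2⟩ := (hs.prev (r - d) (by omega) (by omega)).eq_of_prevEdge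
        ⟨by omega, by omega, he, hright'⟩
      rw [if_pos h1, h2] at hv
      exact Or.inr (hv ▸ he)
  have hag' : Agree f (q - d) (r - d) v := main.elim (fun h => h.1) (fun h => h.1.symm)
  refine ⟨?_, ?_, ?_⟩
  · intro hv'
    rcases main with h1 | h1
    · exact Or.inl (h1.transfer (k := rhs - r) (by omega) (hqd.symm.mono (by omega)) hrd.symm)
    · exact Or.inr (h1.transfer (k := rhs - r) (by omega) hrd.symm (hqd.symm.mono (by omega)))
  · intro hv'
    exact ((hqd.symm.mono (by omega)).trans (hag'.mono (by omega))).trans hrd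
  -- The bound holds even if v overshoots the window; it makes r + v fit into a machine word.
  · have := hf.agree_le (by omega) (by omega) (by omega) hag'
    omega

end Order

end InvLyndon

namespace InvLyndon

/-! ### Total correctness of programs -/

section Runs

variable {V A L : Type*}

@[simp] theorem setReg_reg_same [DecidableEq V] (σ : State V A) (v : V) (k : ℕ) :
    (σ.setReg v k).reg v = k := by
  simp [State.setReg]

@[simp] theorem setReg_reg_ne [DecidableEq V] (σ : State V A) {v w : V} (k : ℕ) (h : w ≠ v) :
    (σ.setReg v k).reg w = σ.reg w := by
  simp [State.setReg, h]

@[simp] theorem setReg_arr [DecidableEq V] (σ : State V A) (v : V) (k : ℕ) :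
    (σ.setReg v k).arr = σ.arr := rfl

@[simp] theorem setArr_arr_same [DecidableEq A] (σ : State V A) (a : A) (p k : ℕ) :
    (σ.setArr a p k).arr a = Function.update (σ.arr a) p k := by
  simp [State.setArr]

@[simp] theorem setArr_arr_ne [DecidableEq A] (σ : State V A) {a b : A} (p k : ℕ) (h : b ≠ a) :
    (σ.setArr a p k).arr b = σ.arr b := by
  simp [State.setArr, h]

@[simp] theorem setArr_reg [DecidableEq A] (σ : State V A) (a : A) (p k : ℕ) :
    (σ.setArr a p k).reg = σ.reg := rfl

variable {M : Machine L} {σ : State V A} {e e' : Expr V A} {a b : ℕ}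

theorem eval_num {k : ℕ} (h : k ≤ M.maxWord) : (Expr.num k : Expr V A).eval M σ = some k := by
  simp [Expr.eval, Machine.word, h]

theorem eval_var (v : V) : (Expr.var v : Expr V A).eval M σ = some (σ.reg v) := rfl

theorem eval_get {x : A} (he : e.eval M σ = some a) (h : a < M.arrLen) :
    (Expr.get x e).eval M σ = some (σ.arr x a) := by
  simp [Expr.eval, Machine.read, he, h]

theorem eval_add (he : e.eval M σ = some a) (he' : e'.eval M σ = some b)
    (h : a + b ≤ M.maxWord) : (Expr.add e e').eval M σ = some (a + b) := by
  simp [Expr.eval, Machine.word, he, he', h]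

theorem eval_sub (he : e.eval M σ = some a) (he' : e'.eval M σ = some b)
    (h : a - b ≤ M.maxWord) : (Expr.sub e e').eval M σ = some (a - b) := by
  simp only [Expr.eval, Machine.word, he, he', Option.bind_some, if_pos h]

theorem eval_numLt [LinearOrder L] (he : e.eval M σ = some a) (he' : e'.eval M σ = some b) :
    (Test.numLt e e').eval M σ = some (decide (a < b)) := by
  simp [Test.eval, he, he']

theorem eval_numEq [LinearOrder L] (he : e.eval M σ = some a) (he' : e'.eval M σ = some b) :
    (Test.numEq e e').eval M σ = some (decide (a = b)) := by
  simp [Test.eval, he, he']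

theorem eval_letterLt [LinearOrder L] {x y : L} (he : e.eval M σ = some a) (he' : e'.eval M σ = some b)
    (hx : M.letter a = some x) (hy : M.letter b = some y) :
    (Test.letterLt e e').eval M σ = some (decide (x < y)) := by
  simp [Test.eval, he, he', hx, hy]

theorem eval_letterEq [LinearOrder L] {x y : L} (he : e.eval M σ = some a) (he' : e'.eval M σ = some b)
    (hx : M.letter a = some x) (hy : M.letter b = some y) :
    (Test.letterEq e e').eval M σ = some (decide (x = y)) := by
  simp [Test.eval, he, he', hx, hy]

variable [DecidableEq V] [DecidableEq A] [LinearOrder L]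

/-- The program `s` started in `σ` halts without exceeding the resources of `M`, and its running
time and final state satisfy `Q`. -/
def Runs (M : Machine L) (s : Stmt V A) (σ : State V A) (Q : ℕ → State V A → Prop) : Prop :=
  ∃ t σ', Exec M s σ t σ' ∧ Q t σ'

variable {Q Q' : ℕ → State V A → Prop} {s s' : Stmt V A} {c : Test V A}

theorem Runs.mono (h : Runs M s σ Q) (hQ : ∀ t σ', Q t σ' → Q' t σ') : Runs M s σ Q' := by
  obtain ⟨t, σ', h1, h2⟩ := h
  exact ⟨t, σ', h1, hQ _ _ h2⟩

theorem Runs.skip (h : Q 1 σ) : Runs M .skip σ Q := ⟨_, _, .skip σ, h⟩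

theorem Runs.assign {v : V} (he : e.eval M σ = some a) (h : Q (e.cost + 1) (σ.setReg v a)) :
    Runs M (.assign v e) σ Q := ⟨_, _, .assign σ v e a he, h⟩

theorem Runs.store {x : A} (he : e.eval M σ = some a) (ha : a < M.arrLen)
    (he' : e'.eval M σ = some b) (h : Q (e.cost + e'.cost + 1) (σ.setArr x a b)) :
    Runs M (.store x e e') σ Q := ⟨_, _, .store σ x e e' a b he ha he', h⟩

theorem Runs.seq (h : Runs M s σ fun t σ' => Runs M s' σ' fun t' σ'' => Q (t + t') σ'') :
    Runs M (s ;; s') σ Q := by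
  obtain ⟨t, σ', h1, t', σ'', h2, h3⟩ := h
  exact ⟨_, _, .seq h1 h2, h3⟩

theorem Runs.assign_seq {v : V} (he : e.eval M σ = some a)
    (h : Runs M s (σ.setReg v a) fun t σ' => Q (e.cost + 1 + t) σ') :
    Runs M (.assign v e ;; s) σ Q := .seq (.assign he h)

theorem Runs.store_seq {x : A} (he : e.eval M σ = some a) (ha : a < M.arrLen)
    (he' : e'.eval M σ = some b)
    (h : Runs M s (σ.setArr x a b) fun t σ' => Q (e.cost + e'.cost + 1 + t) σ') :
    Runs M (.store x e e' ;; s) σ Q := .seq (.store he ha he' h)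

theorem Runs.branch {d : Bool} (hc : c.eval M σ = some d)
    (htrue : d = true → Runs M s σ fun t σ' => Q (c.cost + t + 1) σ')
    (hfalse : d = false → Runs M s' σ fun t σ' => Q (c.cost + t + 1) σ') :
    Runs M (.branch c s s') σ Q := by
  cases d with
  | true =>
    obtain ⟨t, σ', h1, h2⟩ := htrue rfl
    exact ⟨_, _, .branch_true hc h1, h2⟩
  | false =>
    obtain ⟨t, σ', h1, h2⟩ := hfalse rfl
    exact ⟨_, _, .branch_false hc h1, h2⟩

/-- A loop whose passes are paid for by the potential `μ`. -/
theorem Runs.loop (I : State V A → Prop) (μ : State V A → ℕ)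
    (hstep : ∀ σ, I σ → c.eval M σ = some false ∨ c.eval M σ = some true ∧
      Runs M s σ fun t σ' => I σ' ∧ c.cost + t + 1 + μ σ' ≤ μ σ) (hI : I σ) :
    Runs M (.loop c s) σ fun t σ' => I σ' ∧ c.eval M σ' = some false ∧
      t + μ σ' ≤ μ σ + c.cost + 1 := by
  induction hk : μ σ using Nat.strong_induction_on generalizing σ with
  | _ k ih =>
    rcases hstep σ hI with h | ⟨h, t, σ', h1, h2, h3⟩
    · exact ⟨_, _, .loop_false h, hI, h, by omega⟩
    -- A pass has positive cost, so μ strictly decreases.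
    · obtain ⟨t', σ'', g1, g2, g3, g4⟩ := ih (μ σ') (by omega) h2 rfl
      exact ⟨_, _, .loop_true h h1 g1, g2, g3, by omega⟩

end Runs

/-! ### The parts of the algorithm -/

section Algorithm

variable {L : Type*} [LinearOrder L] {M : Machine L} {f : ℕ → L} {n : ℕ} {σ : State Reg Arr}

/-- The machine `M` has the text with letters `f 1, …, f n`, and just enough resources for the
algorithm. -/
structure Fits (M : Machine L) (f : ℕ → L) (n : ℕ) : Prop where
  arrLen : M.arrLen = n + 1
  maxWord : M.maxWord = 2 * n + 1
  letter : ∀ p, 1 ≤ p → p ≤ n → M.letter p = some (f p)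

theorem Fits.eval_letterEq (hM : Fits M f n) (u v k : Reg) (hu : 1 ≤ σ.reg u)
    (huv : σ.reg u < σ.reg v) (hv : σ.reg v + σ.reg k ≤ n) :
    (Test.letterEq (.add (.var u) (.var k)) (.add (.var v) (.var k)) : Test Reg Arr).eval M σ =
      some (decide (f (σ.reg u + σ.reg k) = f (σ.reg v + σ.reg k))) := by
  obtain ⟨h1, h2, h3⟩ := hM
  exact InvLyndon.eval_letterEq (eval_add (eval_var u) (eval_var k) (by omega))
    (eval_add (eval_var v) (eval_var k) (by omega)) (h3 _ (by omega) (by omega))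
    (h3 _ (by omega) hv)

theorem Fits.eval_letterLt (hM : Fits M f n) (u v k : Reg) (hu : 1 ≤ σ.reg u)
    (huv : σ.reg u < σ.reg v) (hv : σ.reg v + σ.reg k ≤ n) :
    (Test.letterLt (.add (.var u) (.var k)) (.add (.var v) (.var k)) : Test Reg Arr).eval M σ =
      some (decide (f (σ.reg u + σ.reg k) < f (σ.reg v + σ.reg k))) := by
  obtain ⟨h1, h2, h3⟩ := hM
  exact InvLyndon.eval_letterLt (eval_add (eval_var u) (eval_var k) (by omega))
    (eval_add (eval_var v) (eval_var k) (by omega)) (h3 _ (by omega) (by omega))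
    (h3 _ (by omega) hv)

/-- The states differ at most in the registers that `smartLce` writes. -/
def SameData (σ σ' : State Reg Arr) : Prop :=
  σ'.arr = σ.arr ∧ ∀ v, v ≠ .m → v ≠ .rhs → v ≠ .dist → σ'.reg v = σ.reg v

/-- The suffixes at `i` and `j` have LCE `e`, with a mismatch after it. -/
def MismatchAt (f : ℕ → L) (i j e : ℕ) : Prop := LtAt f i j e ∨ LtAt f j i e

theorem MismatchAt.agree {i j e : ℕ} (h : MismatchAt f i j e) : Agree f i j e :=
  h.elim (fun h => h.1) fun h => h.1.symm

/-- A successful test with its increment costs 12, paid by one advance of r + m, which starts at or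
beyond the old `rhs`. The 16 pays for the failing test and the two assignments. -/
theorem extend_runs (hM : Fits M f n) (hf : Framed f n) (hq : 1 ≤ σ.reg .q)
    (hqr : σ.reg .q < σ.reg .r) (hr : σ.reg .r ≤ n)
    (hag : Agree f (σ.reg .q) (σ.reg .r) (σ.reg .m)) (hrhs : σ.reg .rhs ≤ σ.reg .r + σ.reg .m) :
    Runs M extend σ fun t σ' => SameData σ σ' ∧
      MismatchAt f (σ.reg .q) (σ.reg .r) (σ'.reg .m) ∧
      σ'.reg .rhs = σ.reg .r + σ'.reg .m ∧ σ'.reg .dist = σ.reg .r - σ.reg .q ∧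
      σ.reg .rhs ≤ σ'.reg .rhs ∧ σ'.reg .rhs ≤ n ∧
      t + 12 * (n - σ'.reg .rhs) ≤ 12 * (n - σ.reg .rhs) + 16 := by
  obtain ⟨h1, h2, h3⟩ := id hM
  refine .seq ((Runs.loop (fun τ => τ.arr = σ.arr ∧ (∀ v, v ≠ .m → τ.reg v = σ.reg v) ∧
      σ.reg .m ≤ τ.reg .m ∧ Agree f (σ.reg .q) (σ.reg .r) (τ.reg .m))
    (fun τ => 12 * (n - (σ.reg .r + τ.reg .m))) ?_ ⟨rfl, fun _ _ => rfl, le_rfl, hag⟩).mono ?_)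
  · rintro τ ⟨ha, hv, hm, hag'⟩
    have hle := hf.agree_le hq hqr hr hag'
    have hτr := hv .r (by simp)
    have hτq := hv .q (by simp)
    have he := hM.eval_letterEq (σ := τ) .q .r .m (by omega) (by omega) (by omega)
    rw [hτq, hτr] at he
    by_cases hc : f (σ.reg .q + τ.reg .m) = f (σ.reg .r + τ.reg .m)
    · have hag'' := hag'.succ hc
      have hle' := hf.agree_le hq hqr hr hag''
      refine Or.inr ⟨by rw [he, decide_eq_true hc], ?_⟩
      refine .assign (eval_add (eval_var Reg.m) (eval_num (by omega)) (by omega)) ?_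
      refine ⟨⟨by simpa using ha, fun v hvm => by simp [hvm, hv], ?_, ?_⟩, ?_⟩
      · simp; omega
      · simpa using hag''
      · simp [Test.cost, Expr.cost]; omega
    · exact Or.inl (by rw [he, decide_eq_false hc])
  · rintro t τ ⟨⟨ha, hv, hm, hag'⟩, hc, ht⟩
    have hle := hf.agree_le hq hqr hr hag'
    have hτr := hv .r (by simp)
    have hτq := hv .q (by simp)
    have he := hM.eval_letterEq (σ := τ) .q .r .m (by omega) (by omega) (by omega)
    rw [hτq, hτr] at he
    have hne : f (σ.reg .q + τ.reg .m) ≠ f (σ.reg .r + τ.reg .m) := by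
      rw [he] at hc
      simpa using hc
    refine .assign_seq (eval_add (eval_var Reg.r) (eval_var Reg.m) (by omega)) ?_
    refine .assign (eval_sub (eval_var Reg.r) (eval_var Reg.q) (by simp; omega)) ?_
    refine ⟨⟨by simpa using ha, fun v a b c => by simp [a, b, c, hv]⟩, ?_, ?_⟩
    · simp only [ne_eq, reduceCtorEq, not_false_eq_true, setReg_reg_ne]
      exact (lt_or_gt_of_ne hne).imp (fun h => ⟨hag', h⟩) fun h => ⟨hag'.symm, h⟩
    · simp [Test.cost, Expr.cost, hτr, hτq] at ht ⊢
      omega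

/-- The hypotheses are what `Window.copy` needs; a window with r' ≤ q is required only if r + m lies
before `rhs`. The disjunction records whether the window was kept or replaced by the one of (q, r).
-/
theorem smartLce_runs (hM : Fits M f n) (hf : Framed f n) (hq : 1 ≤ σ.reg .q)
    (hqr : σ.reg .q < σ.reg .r) (hr : σ.reg .r ≤ n) (hrhs : σ.reg .rhs ≤ n)
    (hag : Agree f (σ.reg .q) (σ.reg .r) (σ.reg .m))
    (hs : Stored f (σ.arr .prev) (σ.arr .plce) (σ.arr .next) (σ.arr .nlce) (σ.reg .r))
    (hw : σ.reg .r + σ.reg .m < σ.reg .rhs → ∃ q' r', Window f q' r' (σ.reg .rhs) ∧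
      σ.reg .dist = r' - q' ∧ r' ≤ σ.reg .q)
    (hleft : ∀ j, σ.reg .q < j → j < σ.reg .r → ∃ e, e ≤ σ.reg .m ∧ LtAt f j (σ.reg .q) e)
    (hright : ∀ j, σ.reg .q < j → j < σ.reg .r → ∃ e, e ≤ σ.reg .m ∧ LtAt f j (σ.reg .r) e) :
    Runs M smartLce σ fun t σ' => SameData σ σ' ∧
      MismatchAt f (σ.reg .q) (σ.reg .r) (σ'.reg .m) ∧
      (σ.reg .r + σ.reg .m < σ.reg .rhs ∧ σ'.reg .rhs = σ.reg .rhs ∧ σ'.reg .dist = σ.reg .dist ∨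
        σ'.reg .rhs = σ.reg .r + σ'.reg .m ∧ σ'.reg .dist = σ.reg .r - σ.reg .q) ∧
      σ'.reg .rhs ≤ n ∧
      t + 12 * (n - σ'.reg .rhs) ≤ 12 * (n - σ.reg .rhs) + 50 := by
  obtain ⟨h1, h2, h3⟩ := id hM
  have hle := hf.agree_le hq hqr hr hag
  refine .branch (eval_numLt (eval_add (eval_var Reg.r) (eval_var Reg.m) (by omega)) (eval_var Reg.rhs))
    (fun hc => ?_) (fun hc => ?_)
  · have hlt := of_decide_eq_true hc
    obtain ⟨q', r', hwin, hd, hr'⟩ := hw hlt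
    have hqr' := hwin.lt
    obtain ⟨v, hv⟩ : ∃ v, v = if σ.arr .prev (σ.reg .r - (r' - q')) = σ.reg .q - (r' - q')
      then σ.arr .plce (σ.reg .r - (r' - q')) else σ.arr .nlce (σ.reg .q - (r' - q')) := ⟨_, rfl⟩
    obtain ⟨hin, hout, hvn⟩ := hwin.copy hf hs hr' hqr hr hlt hleft hright hv
    rw [← hd] at hv
    refine .seq (Runs.mono (Q := fun t σ' => t ≤ 14 ∧ σ' = σ.setReg .m v) ?_ ?_)
    · refine .branch (eval_numEq
        (eval_get (eval_sub (eval_var Reg.r) (eval_var Reg.dist) (by omega)) (by omega))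
        (eval_sub (eval_var Reg.q) (eval_var Reg.dist) (by omega))) (fun hc => ?_) (fun hc => ?_)
      · rw [if_pos (of_decide_eq_true hc)] at hv
        refine .assign
          (eval_get (eval_sub (eval_var Reg.r) (eval_var Reg.dist) (by omega)) (by omega)) ?_
        exact ⟨by simp [Test.cost, Expr.cost], by rw [hv]⟩
      · rw [if_neg (of_decide_eq_false hc)] at hv
        refine .assign
          (eval_get (eval_sub (eval_var Reg.q) (eval_var Reg.dist) (by omega)) (by omega)) ?_
        exact ⟨by simp [Test.cost, Expr.cost], by rw [hv]⟩
    · rintro t _ ⟨ht, rfl⟩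
      refine .branch (eval_numLt (eval_add (eval_var Reg.r) (eval_var Reg.m) ?_)
        (eval_var Reg.rhs)) (fun hc => ?_) (fun hc => ?_)
      · simp; omega
      · have hlt' : σ.reg .r + v < σ.reg .rhs := by simpa using hc
        refine .skip ⟨⟨rfl, fun w a _ _ => by simp [a]⟩, ?_, Or.inl ⟨hlt, ?_, ?_⟩, ?_, ?_⟩
        · simpa [MismatchAt] using hin hlt'
        · simp
        · simp
        · simpa using hrhs
        · simp [Test.cost, Expr.cost]; omega
      -- A copied value that reaches the end certifies agreement only up to `rhs`, so the scan
      -- resumes there.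
      · have hge : σ.reg .rhs ≤ σ.reg .r + v := by simpa using hc
        refine .assign_seq (eval_sub (eval_var Reg.rhs) (eval_var Reg.r) ?_) ?_
        · simp; omega
        refine (extend_runs hM hf ?_ ?_ ?_ ?_ ?_).mono ?_
        · simpa using hq
        · simpa using hqr
        · simpa using hr
        · simpa using hout hge
        · simp; omega
        rintro t' σ' ⟨⟨g0, g1⟩, g2, g3, g4, g5, g6, g7⟩
        simp at g2 g3 g4 g5 g7
        refine ⟨⟨by simpa using g0, fun w a b c => ?_⟩, g2, Or.inr ⟨g3, g4⟩, g6, ?_⟩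
        · rw [g1 w a b c]; simp [a]
        · simp [Test.cost, Expr.cost]; omega
  · refine (extend_runs hM hf hq hqr hr hag (by simpa using hc)).mono ?_
    rintro t σ' ⟨g1, g2, g3, g4, g5, g6, g7⟩
    refine ⟨g1, g2, Or.inr ⟨g3, g4⟩, g6, ?_⟩
    simp [Test.cost, Expr.cost]; omega

end Algorithm

end InvLyndon

namespace InvLyndon

section Algorithm

variable {L : Type*} [LinearOrder L] {M : Machine L} {f : ℕ → L} {n r : ℕ} {σ : State Reg Arr}

/-! ### Invariants and amortized cost of the two loops. -/

/-- The values that `setup` stores and that are never overwritten. -/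
structure Boundary (σ : State Reg Arr) (n : ℕ) : Prop where
  prev_one : σ.arr .prev 1 = 0
  plce_one : σ.arr .plce 1 = 0
  next_one : σ.arr .next 1 = n + 1
  nlce_one : σ.arr .nlce 1 = 0
  next_last : σ.arr .next n = n + 1
  nlce_last : σ.arr .nlce n = 0

/-- The arrays of `σ` hold the edges of the suffixes before `r`. -/
def StoredIn (f : ℕ → L) (σ : State Reg Arr) (r : ℕ) : Prop :=
  Stored f (σ.arr .prev) (σ.arr .plce) (σ.arr .next) (σ.arr .nlce) r

/-- The registers hold a window, about which `P` holds, or no window. -/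
def WindowIn (f : ℕ → L) (σ : State Reg Arr) (P : ℕ → Prop) : Prop :=
  σ.reg .rhs = 0 ∨ ∃ q' r', Window f q' r' (σ.reg .rhs) ∧ σ.reg .dist = r' - q' ∧ P r'

/-- The invariant of `climb`. -/
structure ClimbInv (f : ℕ → L) (n r : ℕ) (σ : State Reg Arr) : Prop where
  reg_n : σ.reg .n = n
  reg_r : σ.reg .r = r
  pos : 1 ≤ σ.reg .l
  lt : σ.reg .l < r
  mismatch : MismatchAt f (σ.reg .l) r (σ.reg .m)
  less_left : ∀ j, σ.reg .l < j → j < r → Less f j (σ.reg .l)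
  less_right : ∀ j, σ.reg .l < j → j < r → Less f j r
  stored : StoredIn f σ r
  next : ∀ i e, σ.reg .l < i → NextEdge f i r e → σ.arr .next i = r ∧ σ.arr .nlce i = e
  boundary : Boundary σ n
  rhs_le : σ.reg .rhs ≤ n
  window : WindowIn f σ fun r' =>
    r' < r ∨ r' = r ∧ (σ.reg .rhs ≤ r + σ.reg .m ∨ LtAt f r (σ.reg .l) (σ.reg .m))

/-- With l' = prev[l] and p = plce[l], the earlier of the mismatches (l, l') and (l, r) decides (l',
r): if p < m, then r is below l' and the loop will stop; if m < p, then l' is below r. Only m = p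
needs a query. A window made in the current pass has r' = r and must not be copied from; the
invariant ensures that then either r + m has reached `rhs` or no further query follows. -/
theorem ClimbInv.step (hM : Fits M f n) (hf : Framed f n) (hr : r ≤ n) (h : ClimbInv f n r σ)
    (hlt : LtAt f (σ.reg .l) r (σ.reg .m)) :
    Runs M (.store .next (.var .l) (.var .r) ;;
      .store .nlce (.var .l) (.var .m) ;;
      .branch (.numEq (.var .m) (.get .plce (.var .l)))
        (.assign .q (.get .prev (.var .l)) ;; smartLce)
        (.branch (.numLt (.get .plce (.var .l)) (.var .m))
          (.assign .m (.get .plce (.var .l)))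
          .skip) ;;
      .assign .l (.get .prev (.var .l))) σ fun t σ' => ClimbInv f n r σ' ∧
        t + (12 * (n - σ'.reg .rhs) + 80 * depth f (σ'.reg .l)) + 10 ≤
          12 * (n - σ.reg .rhs) + 80 * depth f (σ.reg .l) := by
  obtain ⟨h1, h2, h3⟩ := id hM
  obtain ⟨hn, hr', hpos, hlr, hmis, hll, hlr', hst, hnext, hbd, hrhs, hwin⟩ := h
  -- Position 1 has the greatest suffix, so the climb stops there at the latest.
  have hl2 : 2 ≤ σ.reg .l := by
    by_contra hl
    obtain hl1 : σ.reg .l = 1 := by omega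
    rw [hl1] at hlt
    exact (hf.less_first (by omega) hr).asymm ⟨_, hlt⟩
  have hp := hst.prev _ hl2 hlr
  obtain ⟨l, hl⟩ : ∃ l, l = σ.reg .l := ⟨_, rfl⟩
  obtain ⟨m, hm⟩ : ∃ m, m = σ.reg .m := ⟨_, rfl⟩
  obtain ⟨l', hl'⟩ : ∃ l', l' = σ.arr .prev l := ⟨_, rfl⟩
  obtain ⟨p, hpl⟩ : ∃ p, p = σ.arr .plce l := ⟨_, rfl⟩
  rw [← hl, ← hpl, ← hl'] at hp
  rw [← hl] at hpos hlr hmis hll hlr' hnext hl2 hlt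
  rw [← hm] at hmis hlt
  have hdep := hp.depth_eq
  obtain ⟨hp1, hp2, hp3, hp4⟩ := id hp
  have hleft : ∀ j, l' < j → j < r → ∃ e, e ≤ p ∧ LtAt f j l' e := fun j hj hjr => by
    rcases lt_trichotomy j l with hjl | rfl | hjl
    · obtain ⟨e, he⟩ := hp4 j hj hjl
      exact ⟨_, min_le_right _ _, he.trans hp3⟩
    · exact ⟨p, le_rfl, hp3⟩
    · obtain ⟨e, he⟩ := hll j hjl hjr
      exact ⟨_, min_le_right _ _, he.trans hp3⟩
  have hright : ∀ j, l' < j → j < r → ∃ e, e ≤ m ∧ LtAt f j r e := fun j hj hjr => by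
    rcases lt_trichotomy j l with hjl | rfl | hjl
    · obtain ⟨e, he⟩ := hp4 j hj hjl
      exact ⟨_, min_le_right _ _, he.trans hlt⟩
    · exact ⟨m, le_rfl, hlt⟩
    · obtain ⟨e, he⟩ := hll j hjl hjr
      exact ⟨_, min_le_right _ _, he.trans hlt⟩
  refine .store_seq (eval_var Reg.l) (by omega) (eval_var Reg.r) ?_
  refine .store_seq (eval_var Reg.l) (by simp; omega) (eval_var Reg.m) ?_
  obtain ⟨τ, hτ⟩ : ∃ τ, τ = (σ.setArr .next (σ.reg .l) (σ.reg .r)).setArr .nlce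
    ((σ.setArr .next (σ.reg .l) (σ.reg .r)).reg .l)
    ((σ.setArr .next (σ.reg .l) (σ.reg .r)).reg .m) := ⟨_, rfl⟩
  rw [← hτ]
  have τreg : τ.reg = σ.reg := by rw [hτ]; rfl
  have τprev : τ.arr .prev = σ.arr .prev := by simp [hτ]
  have τplce : τ.arr .plce = σ.arr .plce := by simp [hτ]
  have τnext : τ.arr .next = Function.update (σ.arr .next) l r := by simp [hτ, hl, hr']
  have τnlce : τ.arr .nlce = Function.update (σ.arr .nlce) l m := by simp [hτ, hl, hm]
  have τst : StoredIn f τ r := by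
    refine ⟨fun i hi hir => ?_, fun i k e hi hk he => ?_⟩
    · rw [τprev, τplce]; exact hst.prev i hi hir
    -- Overwriting cell l is harmless: all suffixes in (l, r) are smaller, so l has no next edge
    -- ending before r.
    · have hil : i ≠ l := by
        rintro rfl
        exact (hll k he.1 hk).asymm ⟨e, he.2.1⟩
      rw [τnext, τnlce, Function.update_of_ne hil, Function.update_of_ne hil]
      exact hst.next i k e hi hk he
  -- A position strictly between l' and l has a greater suffix at l already, so its next edge cannot
  -- end at r.
  have τnx : ∀ i e, l' < i → NextEdge f i r e → τ.arr .next i = r ∧ τ.arr .nlce i = e := by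
    intro i e hi he
    rw [τnext, τnlce]
    rcases lt_trichotomy i l with hil | rfl | hil
    · exact ((he.2.2 l hil hlr).asymm (hp4 i hi hil)).elim
    · simpa using hlt.eq_of_ltAt he.2.1
    · rw [Function.update_of_ne hil.ne', Function.update_of_ne hil.ne']
      exact hnext i e hil he
  have τbd : Boundary τ n := by
    have e1 : 1 ≠ l := by omega
    have e2 : n ≠ l := by omega
    obtain ⟨b1, b2, b3, b4, b5, b6⟩ := hbd
    constructor <;> simp [τprev, τplce, τnext, τnlce, e1, e2, b1, b2, b3, b4, b5, b6]
  refine .seq (Runs.mono (Q := fun t σ' => σ'.arr = τ.arr ∧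
    (∀ v, v ≠ .m → v ≠ .rhs → v ≠ .dist → v ≠ .q → σ'.reg v = σ.reg v) ∧
    MismatchAt f l' r (σ'.reg .m) ∧ σ'.reg .rhs ≤ n ∧ (WindowIn f σ' fun r' =>
      r' < r ∨ r' = r ∧ (σ'.reg .rhs ≤ r + σ'.reg .m ∨ LtAt f r l' (σ'.reg .m))) ∧
    t + 12 * (n - σ'.reg .rhs) ≤ 12 * (n - σ.reg .rhs) + 60) ?_ ?_)
  · refine .branch (eval_numEq (eval_var Reg.m)
      (eval_get (eval_var Reg.l) (by rw [τreg]; omega))) (fun hc => ?_) (fun hc => ?_)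
    · have hmp : m = p := by
        have := of_decide_eq_true hc
        rwa [τreg, τplce, ← hl, ← hm, ← hpl] at this
      subst hmp
      refine .assign_seq (eval_get (eval_var Reg.l) (by rw [τreg]; omega)) ?_
      rw [τreg, τprev, ← hl, ← hl']
      refine (smartLce_runs (σ := τ.setReg .q l') hM hf ?_ ?_ ?_ ?_ ?_ ?_ ?_ ?_ ?_).mono ?_
      · simpa using hp1
      · simp [τreg, hr']; omega
      · simpa [τreg, hr'] using hr
      · simpa [τreg] using hrhs
      · simpa [τreg, hr', ← hm] using hp3.1.symm.trans hlt.1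
      · simpa [τreg, hr', StoredIn] using τst
      · simp only [ne_eq, reduceCtorEq, not_false_eq_true, setReg_reg_ne, setReg_reg_same, τreg, hr',
          ← hm]
        intro hlr
        rcases hwin with hz | ⟨q', r', hw, hd, hcase⟩
        · omega
        · refine ⟨q', r', hw, hd, ?_⟩
          have hr'r : r' < r := by
            rcases hcase with h | ⟨_, h | h⟩
            · exact h
            · omega
            · rw [← hl, ← hm] at h; exact (h.asymm hlt).elim
          exact hw.le_of_prevEdge hr'r hlr (by omega) hp hlt hll
      · simpa [τreg, hr', ← hm] using hleft
      · simpa [τreg, hr', ← hm] using hright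
      rintro t σ' ⟨⟨g0, g1⟩, g2, g3, g4, g5⟩
      simp [τreg, hr', ← hm] at g0 g1 g2 g3 g5
      refine ⟨g0, fun v a b c d => ?_, g2, g4, ?_, ?_⟩
      · rw [g1 v a b c]; simp [d, τreg]
      · rcases g3 with ⟨g6, g7, g8⟩ | ⟨g6, g7⟩
        · rw [WindowIn, g7, g8]
          rcases hwin with hz | ⟨q', r', hw, hd, hcase⟩
          · omega
          · refine Or.inr ⟨q', r', hw, hd, Or.inl ?_⟩
            rcases hcase with h | ⟨_, h | h⟩
            · exact h
            · omega
            · rw [← hl, ← hm] at h; exact (h.asymm hlt).elim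
        · refine Or.inr ⟨l', r, ⟨hp1, by omega, ?_, fun j hj hjr => ?_⟩, g7, Or.inr ⟨rfl, ?_⟩⟩
          · rw [g6, Nat.add_sub_cancel_left]; exact g2.agree
          · obtain ⟨e, _, he⟩ := hleft j hj hjr
            exact ⟨e, he⟩
          · exact Or.inl g6.le
      · simp [Test.cost, Expr.cost] at g5 ⊢; omega
    · have hmp : m ≠ p := by
        have := of_decide_eq_false hc
        rwa [τreg, τplce, ← hl, ← hm, ← hpl] at this
      refine .branch (eval_numLt (eval_get (eval_var Reg.l) (by rw [τreg]; omega))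
        (eval_var Reg.m)) (fun hc => ?_) (fun hc => ?_)
      · have hpm : p < m := by
          have := of_decide_eq_true hc
          rwa [τreg, τplce, ← hl, ← hm, ← hpl] at this
        have hlt' : LtAt f r l' p := by
          have := hp3.transfer (k := m) (i' := r) hpm hlt.1.symm fun _ _ => rfl
          exact this
        refine .assign (eval_get (eval_var Reg.l) (by rw [τreg]; omega)) ?_
        rw [τreg, τplce, ← hl, ← hpl]
        refine ⟨rfl, fun v a _ _ _ => by simp [a, τreg], ?_, by simpa [τreg] using hrhs, ?_, ?_⟩
        · simpa [MismatchAt] using Or.inr hlt'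
        · rcases hwin with hz | ⟨q', r', hw, hd, hcase⟩
          · exact Or.inl (by simpa [τreg] using hz)
          · refine Or.inr ⟨q', r', by simpa [τreg] using hw, by simpa [τreg] using hd, ?_⟩
            exact hcase.imp_right fun h => ⟨h.1, Or.inr (by simpa using hlt')⟩
        · simp [Test.cost, Expr.cost, τreg]; omega
      · have hpm : m < p := by
          have := of_decide_eq_false hc
          rw [τreg, τplce, ← hl, ← hm, ← hpl] at this
          omega
        have hlt' : LtAt f l' r m :=
          hlt.transfer (k := p) hpm hp3.1.symm fun _ _ => rfl
        refine .skip ⟨rfl, fun v _ _ _ _ => by rw [τreg], ?_, by rwa [τreg], ?_, ?_⟩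
        · rw [τreg, ← hm]; exact Or.inl hlt'
        · rw [WindowIn, τreg]
          rcases hwin with hz | ⟨q', r', hw, hd, hcase⟩
          · exact Or.inl hz
          · refine Or.inr ⟨q', r', hw, hd, ?_⟩
            rcases hcase with h | ⟨h, h' | h'⟩
            · exact Or.inl h
            · exact Or.inr ⟨h, Or.inl h'⟩
            · rw [← hl, ← hm] at h'; exact (h'.asymm hlt).elim
        · simp [Test.cost, Expr.cost, τreg]; omega
  · rintro t σ' ⟨g0, g1, g2, g3, g4, g5⟩
    have gl := g1 .l (by simp) (by simp) (by simp) (by simp)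
    have gn := g1 .n (by simp) (by simp) (by simp) (by simp)
    have gr := g1 .r (by simp) (by simp) (by simp) (by simp)
    refine .assign (eval_get (eval_var Reg.l) (by rw [gl]; omega)) ?_
    rw [gl, g0, τprev, ← hl, ← hl']
    refine ⟨⟨by simpa [hn] using gn, by simpa [hr'] using gr, by simpa using hp1, ?_,
      by simpa using g2, ?_, ?_, by simpa [StoredIn, g0] using τst, by simpa [g0] using τnx, ?_,
      by simpa using g3, by simpa [WindowIn] using g4⟩, ?_⟩
    · simp; omega
    · simp only [setReg_reg_same]
      intro j hj hjr
      obtain ⟨e, _, he⟩ := hleft j hj hjr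
      exact ⟨e, he⟩
    · simp only [setReg_reg_same]
      intro j hj hjr
      obtain ⟨e, _, he⟩ := hright j hj hjr
      exact ⟨e, he⟩
    · obtain ⟨b1, b2, b3, b4, b5, b6⟩ := τbd
      constructor <;> simpa [g0]
    · simp [Expr.cost, hdep] at g5 ⊢; omega

theorem climb_runs (hM : Fits M f n) (hf : Framed f n) (hr : r ≤ n) (h : ClimbInv f n r σ) :
    Runs M climb σ fun t σ' => ClimbInv f n r σ' ∧ LtAt f r (σ'.reg .l) (σ'.reg .m) ∧
      t + (12 * (n - σ'.reg .rhs) + 80 * depth f (σ'.reg .l)) ≤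
        12 * (n - σ.reg .rhs) + 80 * depth f (σ.reg .l) + 8 := by
  have heval : ∀ τ, ClimbInv f n r τ → (Test.letterLt (.add (.var .l) (.var .m))
      (.add (.var .r) (.var .m)) : Test Reg Arr).eval M τ =
      some (decide (f (τ.reg .l + τ.reg .m) < f (r + τ.reg .m))) := fun τ hτ => by
    have hlt := hτ.lt
    have := hf.agree_le hτ.pos hτ.lt hr hτ.mismatch.agree
    have he := hM.eval_letterLt (σ := τ) .l .r .m hτ.pos (by rw [hτ.reg_r]; exact hlt)
      (by rw [hτ.reg_r]; exact this)
    rwa [hτ.reg_r] at he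
  refine (Runs.loop (ClimbInv f n r)
    (fun τ => 12 * (n - τ.reg .rhs) + 80 * depth f (τ.reg .l)) (fun τ hτ => ?_) h).mono ?_
  · rw [heval τ hτ]
    by_cases hc : f (τ.reg .l + τ.reg .m) < f (r + τ.reg .m)
    · refine Or.inr ⟨by simp [hc], (hτ.step hM hf hr ⟨hτ.mismatch.agree, hc⟩).mono ?_⟩
      rintro t σ' ⟨g1, g2⟩
      refine ⟨g1, ?_⟩
      simp [Test.cost, Expr.cost]; omega
    · exact Or.inl (by simp [hc])
  · rintro t σ' ⟨g1, g2, g3⟩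
    rw [heval σ' g1] at g2
    refine ⟨g1, ?_, by simpa [Test.cost, Expr.cost] using g3⟩
    rcases g1.mismatch with h | h
    · simp [h.2] at g2
    · exact h

/-- The invariant of `sweep`, before the pass for `r`. -/
structure SweepInv (f : ℕ → L) (n : ℕ) (σ : State Reg Arr) : Prop where
  reg_n : σ.reg .n = n
  two_le : 2 ≤ σ.reg .r
  le : σ.reg .r ≤ n + 1
  stored : StoredIn f σ (σ.reg .r)
  boundary : Boundary σ n
  rhs_le : σ.reg .rhs ≤ n
  window : WindowIn f σ fun r' => r' < σ.reg .r

/-- The potential of `sweep`. -/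
noncomputable def sweepPotential (f : ℕ → L) (n : ℕ) (σ : State Reg Arr) : ℕ :=
  12 * (n - σ.reg .rhs) + 80 * depth f (σ.reg .r - 1) + 200 * (n + 1 - σ.reg .r)

/-- The new edge makes r one deeper than the final l. These 80 units, and the constant costs of the
pass, are paid by the 200 reserved for each r. -/
theorem SweepInv.step (hM : Fits M f n) (hf : Framed f n) (h : SweepInv f n σ)
    (hr : σ.reg .r ≤ n) :
    Runs M (.assign .l (.sub (.var .r) (.num 1)) ;;
      .assign .q (.var .l) ;;
      .assign .m (.num 0) ;;
      smartLce ;;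
      climb ;;
      .store .prev (.var .r) (.var .l) ;;
      .store .plce (.var .r) (.var .m) ;;
      .assign .r (.add (.var .r) (.num 1))) σ fun t σ' => SweepInv f n σ' ∧
        t + sweepPotential f n σ' + 6 ≤ sweepPotential f n σ := by
  obtain ⟨h1, h2, h3⟩ := id hM
  obtain ⟨hn, hr2, _, hst, hbd, hrhs, hwin⟩ := h
  obtain ⟨r, hr'⟩ : ∃ r, r = σ.reg .r := ⟨_, rfl⟩
  rw [← hr'] at hr hr2 hst hwin
  refine .assign_seq (eval_sub (eval_var Reg.r) (eval_num (by omega)) (by omega)) ?_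
  refine .assign_seq (eval_var Reg.l) ?_
  refine .assign_seq (eval_num (by omega)) ?_
  rw [← hr', setReg_reg_same]
  obtain ⟨τ, hτ⟩ : ∃ τ, τ = ((σ.setReg .l (r - 1)).setReg .q (r - 1)).setReg .m 0 := ⟨_, rfl⟩
  rw [← hτ]
  have τarr : τ.arr = σ.arr := by rw [hτ]; rfl
  have τl : τ.reg .l = r - 1 := by simp [hτ]
  have τq : τ.reg .q = r - 1 := by simp [hτ]
  have τm : τ.reg .m = 0 := by simp [hτ]
  have τr : τ.reg .r = r := by simp [hτ, hr']
  have τn : τ.reg .n = n := by simp [hτ, hn]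
  have τrhs : τ.reg .rhs = σ.reg .rhs := by simp [hτ]
  have τdist : τ.reg .dist = σ.reg .dist := by simp [hτ]
  refine .seq ((smartLce_runs (σ := τ) hM hf ?_ ?_ ?_ ?_ ?_ ?_ ?_ ?_ ?_).mono ?_)
  · omega
  · omega
  · omega
  · omega
  · rw [τm]; exact Agree.zero
  · rw [τarr, τr]; exact hst
  · rw [τr, τm, τrhs, τq, τdist]
    intro hlt
    rcases hwin with hz | ⟨q', r', hw, hd, hcase⟩
    · omega
    · exact ⟨q', r', hw, hd, by omega⟩
  -- Nothing lies between r - 1 and r.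
  · intro j _ _; omega
  · intro j _ _; omega
  rintro t₁ ρ ⟨⟨g0, g1⟩, g2, g3, g4, g5⟩
  rw [τq, τr] at g2
  have ρl : ρ.reg .l = r - 1 := by rw [g1 _ (by simp) (by simp) (by simp), τl]
  have ρr : ρ.reg .r = r := by rw [g1 _ (by simp) (by simp) (by simp), τr]
  have ρn : ρ.reg .n = n := by rw [g1 _ (by simp) (by simp) (by simp), τn]
  have hinv : ClimbInv f n r ρ := by
    refine ⟨ρn, ρr, by omega, by omega, by rwa [ρl], fun j _ _ => by omega, fun j _ _ => by omega,
      ?_, fun i e hi he => ?_, ?_, g4, ?_⟩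
    · rw [StoredIn, g0, τarr]; exact hst
    · have := he.1; omega
    · obtain ⟨b1, b2, b3, b4, b5, b6⟩ := hbd
      constructor <;> simpa [g0, τarr]
    · rcases g3 with ⟨g6, g7, g8⟩ | ⟨g6, g7⟩
      · rw [WindowIn, g7, g8, τrhs, τdist]
        rcases hwin with hz | ⟨q', r', hw, hd, hcase⟩
        · exact Or.inl hz
        · exact Or.inr ⟨q', r', hw, hd, Or.inl hcase⟩
      · rw [τr] at g6 g7
        rw [τq] at g7
        refine Or.inr ⟨r - 1, r, ⟨by omega, by omega, ?_, fun j _ _ => by omega⟩, g7,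
          Or.inr ⟨rfl, Or.inl g6.le⟩⟩
        rw [g6, Nat.add_sub_cancel_left]; exact g2.agree
  refine .seq ((climb_runs hM hf hr hinv).mono ?_)
  rintro t₂ ω ⟨⟨ωn, ωr, hpos, hlr, hmis, hll, hlr', ωst, hnext, ωbd, ωrhs, ωwin⟩, hlt, ht₂⟩
  have hedge : PrevEdge f (ω.reg .l) r (ω.reg .m) := ⟨hpos, hlr, hlt, hlr'⟩
  have hdep := hedge.depth_eq
  have hle := hf.agree_le hpos hlr hr hmis.agree
  refine .store_seq (eval_var Reg.r) (by omega) (eval_var Reg.l) ?_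
  refine .store_seq (eval_var Reg.r) (by simp; omega) (eval_var Reg.m) ?_
  refine .assign (eval_add (eval_var Reg.r) (eval_num (by omega)) (by simp; omega)) ?_
  simp only [setArr_reg, ωr]
  refine ⟨⟨by simpa using ωn, by simp; omega, by simp; omega, ?_, ?_, by simpa using ωrhs, ?_⟩, ?_⟩
  · simp only [setReg_reg_same]
    refine ⟨fun i hi hir => ?_, fun i k e hi hk he => ?_⟩
    · rcases Nat.lt_succ_iff_lt_or_eq.1 hir with h | rfl
      · simpa [h.ne] using ωst.prev i hi h
      · simpa using hedge
    -- An edge from i < l to r would put l below i and i below r, although r is below l; so all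
    -- edges into r start after l and were stored by the climb.
    · have key : ω.arr .next i = k ∧ ω.arr .nlce i = e := by
        rcases Nat.lt_succ_iff_lt_or_eq.1 hk with h | rfl
        · exact ωst.next i k e hi h he
        · rcases lt_trichotomy i (ω.reg .l) with hil | rfl | hil
          · exact (Less.asymm ⟨_, hlt⟩ ((he.2.2 _ hil hlr).trans ⟨_, he.2.1⟩)).elim
          · exact (hlt.asymm he.2.1).elim
          · exact hnext i e hil he
      simpa using key
  · have e1 : 1 ≠ r := by omega
    obtain ⟨b1, b2, b3, b4, b5, b6⟩ := ωbd
    constructor <;> simpa [e1]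
  · rcases ωwin with hz | ⟨q', r', hw, hd, hcase⟩
    · exact Or.inl (by simpa using hz)
    · exact Or.inr ⟨q', r', by simpa using hw, by simpa using hd, by simp; omega⟩
  · rw [ρl] at ht₂
    simp [sweepPotential, Expr.cost, hdep, ← hr', τrhs] at ht₂ g5 ⊢
    omega

theorem sweep_runs (hM : Fits M f n) (hf : Framed f n) (hn : σ.reg .n = n) (hbd : Boundary σ n)
    (hrhs : σ.reg .rhs = 0) :
    Runs M sweep σ fun t σ' => σ'.reg .n = n ∧ Boundary σ' n ∧ StoredIn f σ' (n + 1) ∧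
      t ≤ 212 * n := by
  obtain ⟨h1, h2, h3⟩ := id hM
  have hn2 := hf.two_le
  refine .assign_seq (eval_num (by omega)) ?_
  have heval : ∀ τ, SweepInv f n τ → (Test.numLt (.var .r) (.add (.var .n) (.num 1)) :
      Test Reg Arr).eval M τ = some (decide (τ.reg .r < n + 1)) := fun τ hτ => by
    have := hτ.reg_n
    have he := eval_numLt (M := M) (σ := τ) (A := Arr) (eval_var Reg.r)
      (eval_add (eval_var Reg.n) (eval_num (k := 1) (by omega)) (by omega))
    rwa [this] at he
  refine (Runs.loop (SweepInv f n) (sweepPotential f n) (fun τ hτ => ?_) ?_).mono ?_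
  · rw [heval τ hτ]
    by_cases hc : τ.reg .r < n + 1
    · refine Or.inr ⟨by simp [hc], (hτ.step hM hf (by omega)).mono ?_⟩
      rintro t σ' ⟨g1, g2⟩
      refine ⟨g1, ?_⟩
      simp [Test.cost, Expr.cost]; omega
    · exact Or.inl (by simp [hc])
  · refine ⟨by simpa using hn, by simp, by simp; omega, ?_, ?_, by simp [hrhs],
      Or.inl (by simpa using hrhs)⟩
    · simp only [setReg_reg_same]
      refine ⟨fun i hi hir => by omega, fun i k e hi hk he => ?_⟩
      have := he.1; omega
    · obtain ⟨b1, b2, b3, b4, b5, b6⟩ := hbd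
      constructor <;> simpa
  · rintro t σ' ⟨g1, g2, g3⟩
    rw [heval σ' g1] at g2
    have hle := g1.le
    have hge : n + 1 ≤ σ'.reg .r := by simpa using g2
    refine ⟨g1.reg_n, g1.boundary, ?_, ?_⟩
    · have := g1.stored
      rwa [show σ'.reg .r = n + 1 by omega] at this
    -- The initial potential is 12 n + 200 (n - 1), as position 1 has depth 0.
    · have hd : depth f 1 = 0 := by
        rw [depth, dif_neg]
        rintro ⟨p, e, hp⟩
        have := hp.1
        have := hp.2.1
        omega
      simp [sweepPotential, Test.cost, Expr.cost, hrhs, hd] at g3 ⊢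
      omega

/-! ### Initialization, recovery and the whole program. -/

theorem setup_runs (hM : Fits M f n) (hf : Framed f n) (hn : σ.reg .n = n) :
    Runs M setup σ fun t σ' => σ'.reg .n = n ∧ Boundary σ' n ∧ σ'.reg .rhs = 0 ∧ t ≤ 40 := by
  obtain ⟨h1, h2, h3⟩ := id hM
  have hn2 := hf.two_le
  have hne : n ≠ 1 := by omega
  refine .store_seq (eval_num (by omega)) (by omega) (eval_num (by omega)) ?_
  refine .store_seq (eval_num (by omega)) (by omega) (eval_num (by omega)) ?_
  refine .store_seq (eval_num (by omega)) (by omega)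
    (eval_add (eval_var Reg.n) (eval_num (by omega)) (by simp; omega)) ?_
  refine .store_seq (eval_num (by omega)) (by omega) (eval_num (by omega)) ?_
  refine .store_seq (eval_var Reg.n) (by simp; omega)
    (eval_add (eval_var Reg.n) (eval_num (by omega)) (by simp; omega)) ?_
  refine .store_seq (eval_var Reg.n) (by simp; omega) (eval_num (by omega)) ?_
  refine .assign_seq (eval_num (by omega)) ?_
  refine .assign (eval_num (by omega)) ?_
  simp only [setArr_reg, hn]
  refine ⟨by simpa using hn, ?_, by simp, by simp [Expr.cost]⟩
  constructor <;> simp [hne.symm]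

theorem recover_runs (hM : Fits M f n) (hf : Framed f n) (hn : σ.reg .n = n)
    (hlam : ∀ i, 1 ≤ i → i ≤ n →
      σ.arr .next i ≤ n + 1 ∧ σ.arr .next i - i + σ.arr .nlce i ≤ 2 * n + 1) :
    Runs M recover σ fun t σ' => (∀ a, a ≠ .lam → σ'.arr a = σ.arr a) ∧
      (∀ i, 1 ≤ i → i ≤ n → σ'.arr .lam i = σ.arr .next i - i + σ.arr .nlce i) ∧
      t ≤ 20 * n + 10 := by
  obtain ⟨h1, h2, h3⟩ := id hM
  have hn2 := hf.two_le
  refine .assign_seq (eval_num (by omega)) ?_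
  have heval : ∀ τ : State Reg Arr, τ.reg .n = n → (Test.numLt (.var .i) (.add (.var .n) (.num 1)) :
      Test Reg Arr).eval M τ = some (decide (τ.reg .i < n + 1)) := fun τ hτ => by
    have he := eval_numLt (M := M) (σ := τ) (A := Arr) (eval_var Reg.i)
      (eval_add (eval_var Reg.n) (eval_num (k := 1) (by omega)) (by omega))
    rwa [hτ] at he
  refine (Runs.loop (fun τ => τ.reg .n = n ∧ 1 ≤ τ.reg .i ∧ τ.reg .i ≤ n + 1 ∧
      (∀ a, a ≠ .lam → τ.arr a = σ.arr a) ∧ ∀ i, 1 ≤ i → i < τ.reg .i →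
        τ.arr .lam i = σ.arr .next i - i + σ.arr .nlce i)
    (fun τ => 20 * (n + 1 - τ.reg .i)) ?_ ?_).mono ?_
  · rintro τ ⟨a1, a2, a3, a4, a5⟩
    rw [heval τ a1]
    by_cases hc : τ.reg .i < n + 1
    · refine Or.inr ⟨by simp [hc], ?_⟩
      obtain ⟨b1, b2⟩ := hlam (τ.reg .i) a2 (by omega)
      have an := a4 .next (by simp)
      have al := a4 .nlce (by simp)
      rw [← an] at b1
      rw [← an, ← al] at b2
      refine .store_seq (eval_var Reg.i) (by omega)
        (eval_add (eval_sub (eval_get (eval_var Reg.i) (by omega)) (eval_var Reg.i) (by omega))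
          (eval_get (eval_var Reg.i) (by omega)) (by omega)) ?_
      refine .assign (eval_add (eval_var Reg.i) (eval_num (by omega)) (by simp; omega)) ?_
      refine ⟨⟨by simpa using a1, by simp, by simp; omega, fun a ha => by simp [ha, a4], ?_⟩, ?_⟩
      · intro i hi hlt
        simp only [setReg_reg_same, setArr_reg] at hlt
        rcases Nat.lt_succ_iff_lt_or_eq.1 hlt with h | rfl
        · simpa [h.ne] using a5 i hi h
        · simp [an, al]
      · simp [Test.cost, Expr.cost]; omega
    · exact Or.inl (by simp [hc])
  · exact ⟨by simpa using hn, by simp, by simp, fun _ _ => rfl, by simp; omega⟩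
  · rintro t τ ⟨⟨a1, a2, a3, a4, a5⟩, hc, ht⟩
    rw [heval τ a1] at hc
    have hge : n + 1 ≤ τ.reg .i := by simpa using hc
    refine ⟨a4, fun i hi hin => a5 i hi (by omega), ?_⟩
    simp [Test.cost, Expr.cost] at ht ⊢; omega

theorem Boundary.next_le (hf : Framed f n) (hbd : Boundary σ n) (hst : StoredIn f σ (n + 1))
    (i : ℕ) (hi : 1 ≤ i) (hin : i ≤ n) :
    σ.arr .next i ≤ n + 1 ∧ σ.arr .next i - i + σ.arr .nlce i ≤ 2 * n + 1 := by
  rcases Nat.eq_or_lt_of_le hi with rfl | h1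
  · rw [hbd.next_one, hbd.nlce_one]; omega
  · rcases Nat.eq_or_lt_of_le hin with rfl | h2
    · rw [hbd.next_last, hbd.nlce_last]; omega
    · obtain ⟨k, e, hk, he⟩ := hf.exists_nextEdge h1 h2
      obtain ⟨h3, h4⟩ := hst.next i k e hi (by omega) he
      have := hf.agree_le hi he.1 hk he.2.1.1
      omega

theorem lceNGS_runs (hM : Fits M f n) (hf : Framed f n) (hn : σ.reg .n = n) :
    Runs M lceNGS σ fun t σ' => Boundary σ' n ∧ StoredIn f σ' (n + 1) ∧
      (∀ i, 1 ≤ i → i ≤ n → σ'.arr .lam i = σ'.arr .next i - i + σ'.arr .nlce i) ∧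
      t ≤ 300 * n := by
  have hn2 := hf.two_le
  refine .seq ((setup_runs hM hf hn).mono ?_)
  rintro t₁ σ₁ ⟨a1, a2, a3, a4⟩
  refine .seq ((sweep_runs hM hf a1 a2 a3).mono ?_)
  rintro t₂ σ₂ ⟨b1, b2, b3, b4⟩
  refine (recover_runs hM hf b1 (b2.next_le hf b3)).mono ?_
  rintro t₃ σ₃ ⟨c1, c2, c3⟩
  have e1 := c1 .next (by simp)
  have e2 := c1 .prev (by simp)
  have e3 := c1 .nlce (by simp)
  have e4 := c1 .plce (by simp)
  refine ⟨?_, ?_, ?_, by omega⟩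
  · obtain ⟨b1, b2, b3, b4, b5, b6⟩ := b2
    constructor <;> simpa [e1, e2, e3, e4]
  · rwa [StoredIn, e1, e2, e3, e4]
  · rwa [e1, e3]

end Algorithm

end InvLyndon

namespace InvLyndon

/-! ### The arrays of a word in terms of its letters -/

section Lists

variable {L : Type*} [LinearOrder L] {d : L} {x : List L} {i j k e m : ℕ}

/-- The letter of `x` at position `p ≥ 1`; `d` is a default value. -/
def letterAt (d : L) (x : List L) (p : ℕ) : L := x.getD (p - 1) d

section

variable {L : Type*} {d : L} {x : List L} {i m : ℕ}

theorem getElem_suffixAt (hi : 1 ≤ i) {t : ℕ} (ht : t < (suffixAt x i).length) :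
    (suffixAt x i)[t] = letterAt d x (i + t) := by
  simp only [suffixAt, List.length_drop] at ht
  have h : i - 1 + t < x.length := by omega
  simp [suffixAt, letterAt, show i + t - 1 = i - 1 + t by omega, h]

theorem length_suffixAt : (suffixAt x i).length = x.length - (i - 1) := by
  simp [suffixAt]

theorem length_subword (hm : i - 1 + m ≤ x.length) : (subword x i m).length = m := by
  simp [subword, length_suffixAt]; omega

theorem getElem_subword (hi : 1 ≤ i) {t : ℕ} (ht : t < (subword x i m).length) :
    (subword x i m)[t] = letterAt d x (i + t) := by
  simp only [subword, List.length_take] at ht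
  simp only [subword, List.getElem_take]
  exact getElem_suffixAt hi _

theorem lce_zero_left : lce x 0 j = 0 := by simp [lce]

theorem lce_length_succ : lce x i (x.length + 1) = 0 := by
  rw [lce]
  split
  · rfl
  · refine IsGreatest.csSup_eq ⟨⟨[], by simp⟩, ?_⟩
    rintro k ⟨u, _, h2, rfl⟩
    simpa [suffixAt] using h2

end

theorem suffixAt_lt_of_ltAt (hi : 1 ≤ i) (hj : 1 ≤ j) (h : LtAt (letterAt d x) i j e)
    (hie : i + e ≤ x.length) (hje : j + e ≤ x.length) : suffixAt x i < suffixAt x j := by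
  refine List.lt_iff_exists.2 (Or.inr ⟨e, ?_, ?_, fun t ht => ?_, ?_⟩)
  · rw [length_suffixAt]; omega
  · rw [length_suffixAt]; omega
  · rw [getElem_suffixAt (d := d) hi, getElem_suffixAt (d := d) hj]
    exact h.1 t ht
  · rw [getElem_suffixAt (d := d) hi, getElem_suffixAt (d := d) hj]
    exact h.2

theorem MismatchAt.bounds {f : ℕ → L} {n : ℕ} (hf : Framed f n) (hi : 1 ≤ i) (hj : 1 ≤ j)
    (hin : i ≤ n) (hjn : j ≤ n) (hne : i ≠ j) (h : MismatchAt f i j e) :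
    i + e ≤ n ∧ j + e ≤ n := by
  rcases lt_or_gt_of_ne hne with hlt | hlt
  · have := hf.agree_le hi hlt hjn h.agree
    omega
  · have := hf.agree_le hj hlt hin h.agree.symm
    omega

/-- A mismatch gives the list order; totality of `Less` gives the converse. -/
theorem suffixAt_lt_iff (hf : Framed (letterAt d x) x.length) (hi : 1 ≤ i) (hj : 1 ≤ j)
    (hin : i ≤ x.length) (hjn : j ≤ x.length) :
    suffixAt x i < suffixAt x j ↔ Less (letterAt d x) i j := by
  have key : ∀ i j, 1 ≤ i → 1 ≤ j → i ≤ x.length → j ≤ x.length → Less (letterAt d x) i j →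
      suffixAt x i < suffixAt x j := by
    rintro i j hi hj hin hjn ⟨e, he⟩
    have hb := MismatchAt.bounds hf hi hj hin hjn (Less.ne ⟨e, he⟩) (Or.inl he)
    exact suffixAt_lt_of_ltAt hi hj he hb.1 hb.2
  refine ⟨fun h => ?_, key i j hi hj hin hjn⟩
  have hne : i ≠ j := by
    rintro rfl
    exact lt_irrefl _ h
  refine (hf.less_total hi hj hin hjn hne).resolve_right fun h' => ?_
  exact lt_asymm h (key j i hj hi hjn hin h')

theorem nextGreater_eq_of_nextEdge (hf : Framed (letterAt d x) x.length) (hi : 1 ≤ i)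
    (hk : k ≤ x.length) (h : NextEdge (letterAt d x) i k e) : nextGreater x i = k := by
  obtain ⟨h1, h2, h3⟩ := h
  refine IsLeast.csInf_eq ⟨Or.inl ⟨h1, hk, ?_⟩, ?_⟩
  · exact (suffixAt_lt_iff hf hi (by omega) (by omega) hk).2 ⟨e, h2⟩
  · rintro j (⟨hj1, hj2, hj3⟩ | rfl)
    · by_contra hlt
      exact ((suffixAt_lt_iff hf hi (by omega) (by omega) hj2).1 hj3).asymm
        (h3 j hj1 (by omega))
    · omega

theorem nextGreater_eq_of_forall (hf : Framed (letterAt d x) x.length) (hi : 1 ≤ i)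
    (h : ∀ j, i < j → j ≤ x.length → Less (letterAt d x) j i) :
    nextGreater x i = x.length + 1 := by
  refine IsLeast.csInf_eq ⟨Or.inr rfl, ?_⟩
  rintro j (⟨hj1, hj2, hj3⟩ | rfl)
  · exact (((suffixAt_lt_iff hf hi (by omega) (by omega) hj2).1 hj3).asymm (h j hj1 hj2)).elim
  · exact le_rfl

theorem prevGreater_eq_of_prevEdge (hf : Framed (letterAt d x) x.length) (hi : i ≤ x.length)
    (h : PrevEdge (letterAt d x) k i e) : prevGreater x i = k := by
  obtain ⟨h1, h2, h3, h4⟩ := h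
  refine IsGreatest.csSup_eq ⟨Or.inl ⟨h1, h2, ?_⟩, ?_⟩
  · exact (suffixAt_lt_iff hf (by omega) h1 hi (by omega)).2 ⟨e, h3⟩
  · rintro j (⟨hj1, hj2, hj3⟩ | rfl)
    · by_contra hlt
      exact ((suffixAt_lt_iff hf (by omega) hj1 hi (by omega)).1 hj3).asymm
        (h4 j (by omega) hj2)
    · omega

theorem prevGreater_one : prevGreater x 1 = 0 := by
  refine IsGreatest.csSup_eq ⟨Or.inr rfl, ?_⟩
  rintro j (⟨hj1, hj2, _⟩ | rfl)
  · omega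
  · exact le_rfl

theorem lce_eq_of_mismatchAt (hi : 1 ≤ i) (hj : 1 ≤ j) (hie : i + e ≤ x.length)
    (hje : j + e ≤ x.length) (h : MismatchAt (letterAt d x) i j e) : lce x i j = e := by
  have hli := length_suffixAt (x := x) (i := i)
  have hlj := length_suffixAt (x := x) (i := j)
  rw [lce, if_neg (by omega)]
  refine IsGreatest.csSup_eq ⟨⟨(suffixAt x i).take e, List.take_prefix _ _, ?_, ?_⟩, ?_⟩
  · rw [List.prefix_iff_eq_take]
    refine List.ext_getElem (by simp; omega) fun t h1 h2 => ?_
    simp only [List.length_take] at h1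
    rw [List.getElem_take, List.getElem_take, getElem_suffixAt (d := d) hi,
      getElem_suffixAt (d := d) hj]
    exact h.agree t (by omega)
  · simp; omega
  · rintro k ⟨u, h1, h2, rfl⟩
    by_contra hlt
    push Not at hlt
    have e1 := h1.getElem hlt
    have e2 := h2.getElem hlt
    rw [getElem_suffixAt (d := d) hi] at e1
    rw [getElem_suffixAt (d := d) hj] at e2
    have heq := e1.symm.trans e2
    rcases h with h | h
    · exact h.2.ne heq
    · exact h.2.ne' heq

/-! ### Inverse Lyndon subwords. -/

/-- A subword that ends with the common prefix of `i` and its next greater suffix `k` starts with a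
prefix of the suffix at `i`, or is smaller. -/
theorem agree_or_ltAt {f : ℕ → L} (hik : i < k) (hless : ∀ j, i < j → j < k → Less f j i)
    (hag : Agree f i k e) (p : ℕ) :
    i < p → Agree f p i (k + e - p) ∨ ∃ t < k + e - p, LtAt f p i t := by
  induction p using Nat.strong_induction_on with
  | _ p ih =>
    intro hp
    rcases Nat.lt_or_ge p k with hpk | hpk
    · obtain ⟨t, ht⟩ := hless p hp hpk
      rcases Nat.lt_or_ge t (k + e - p) with h | h
      · exact Or.inr ⟨t, h, ht⟩
      · exact Or.inl (ht.1.mono h)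
    -- From k on, the subword repeats itself with period k - i, so p can be moved back by one
    -- period.
    · have hcopy : Agree f p (p - (k - i)) (k + e - p) := fun t ht => by
        have := hag (p - k + t) (by omega)
        rw [show i + (p - k + t) = p - (k - i) + t by omega,
          show k + (p - k + t) = p + t by omega] at this
        exact this.symm
      rcases Nat.eq_or_lt_of_le hpk with rfl | hlt
      · rw [show k - (k - i) = i by omega] at hcopy
        exact Or.inl hcopy
      · rcases ih (p - (k - i)) (by omega) (by omega) with h | ⟨t, ht, h⟩
        · exact Or.inl (hcopy.trans (h.mono (by omega)))
        · rcases Nat.lt_or_ge t (k + e - p) with h' | h'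
          · exact Or.inr ⟨t, h', h.transfer h' hcopy fun _ _ => rfl⟩
          · exact Or.inl (hcopy.trans (h.1.mono h'))

/-- By `agree_or_ltAt`, a proper suffix of the subword of length k - i + e is a proper prefix of it
or smaller at a mismatch. A longer subword contains the letter at k + e, and its suffix from k is
greater than the whole. Without a next greater suffix, k = n + 1 and e = 0, and the end of the text
is the only limit. -/
theorem invLyndonArray_eq (hi : 1 ≤ i) (hik : i < k)
    (hless : ∀ j, i < j → j < k → Less (letterAt d x) j i)
    (hk : LtAt (letterAt d x) i k e ∧ k + e ≤ x.length ∨ k = x.length + 1 ∧ e = 0) :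
    invLyndonArray x i = k - i + e := by
  have hag : Agree (letterAt d x) i k e := by
    rcases hk with h | ⟨_, rfl⟩
    · exact h.1.1
    · exact Agree.zero
  refine IsGreatest.csSup_eq ⟨⟨by omega, by omega, ?_⟩, ?_⟩
  · have hlen : (subword x i (k - i + e)).length = k - i + e := length_subword (by omega)
    refine ⟨List.ne_nil_of_length_pos (by omega), fun s hs hs0 hsu => ?_⟩
    obtain ⟨c, hc⟩ : ∃ c, s = (subword x i (k - i + e)).drop c :=
      ⟨_, List.suffix_iff_eq_drop.1 hs⟩
    have hc0 : c ≠ 0 := by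
      rintro rfl
      exact hsu hc
    have hslen : s.length = k - i + e - c := by rw [hc, List.length_drop, hlen]
    have hspos : 0 < s.length := List.length_pos_iff.2 hs0
    have hget : ∀ t (ht : t < s.length), s[t] = letterAt d x (i + c + t) := fun t ht => by
      subst hc
      rw [List.getElem_drop, getElem_subword (d := d) hi]
      rw [Nat.add_assoc]
    rcases agree_or_ltAt hik hless hag (i + c) (by omega) with h | ⟨t, ht, h⟩
    · refine List.lt_iff_exists.2 (Or.inl ⟨?_, by omega⟩)
      refine List.ext_getElem (by simp; omega) fun t h1 h2 => ?_
      rw [hget, List.getElem_take, getElem_subword (d := d) hi]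
      exact h t (by omega)
    · refine List.lt_iff_exists.2 (Or.inr ⟨t, by omega, by omega, fun t' ht' => ?_, ?_⟩)
      · rw [hget, getElem_subword (d := d) hi]
        exact h.1 t' ht'
      · rw [hget, getElem_subword (d := d) hi]
        exact h.2
  · rintro m ⟨hm1, hm2, hne, hm⟩
    by_contra hlt
    rcases hk with ⟨h, hkn⟩ | ⟨rfl, rfl⟩
    · have hlen : (subword x i m).length = m := length_subword (by omega)
      have hslen : ((subword x i m).drop (k - i)).length = m - (k - i) := by
        rw [List.length_drop, hlen]
      have hgt : subword x i m < (subword x i m).drop (k - i) := by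
        refine List.lt_iff_exists.2 (Or.inr ⟨e, by omega, by omega, fun t' ht' => ?_, ?_⟩)
        · rw [List.getElem_drop, getElem_subword (d := d) hi, getElem_subword (d := d) hi,
            ← Nat.add_assoc, show i + (k - i) = k by omega]
          exact h.1 t' ht'
        · rw [List.getElem_drop, getElem_subword (d := d) hi, getElem_subword (d := d) hi,
            ← Nat.add_assoc, show i + (k - i) = k by omega]
          exact h.2
      refine lt_asymm hgt (hm _ (List.drop_suffix _ _) ?_ hgt.ne')
      exact List.ne_nil_of_length_pos (by omega)
    · omega

end Lists

/-! ### The framed word, and the final assembly. -/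

theorem framed_frame {α : Type*} [LinearOrder α] (w : List α) :
    Framed (letterAt ⊤ (frame w)) (frame w).length := by
  have hlen : (frame w).length = w.length + 2 := by simp [frame]
  have h1 : letterAt ⊤ (frame w) 1 = ⊤ := by simp [letterAt, frame]
  have hn : letterAt ⊤ (frame w) (w.length + 2) = ((⊤ : WithTop α) : WithTop (WithTop α)) := by
    simp [letterAt, frame]
  have hlt : ∀ p, 1 < p → p < w.length + 2 →
      letterAt ⊤ (frame w) p < ((⊤ : WithTop α) : WithTop (WithTop α)) := fun p hp hpn => by
    obtain ⟨q, rfl⟩ : ∃ q, p = q + 2 := ⟨p - 2, by omega⟩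
    have hq : q < w.length := by omega
    have : letterAt ⊤ (frame w) (q + 2) = ((w[q] : WithTop α) : WithTop (WithTop α)) := by
      have hfr : frame w = ⊤ :: (w.map (WithTop.some ∘ WithTop.some) ++
          [((⊤ : WithTop α) : WithTop (WithTop α))]) := by
        simp [frame, List.map_eq_flatMap, Function.comp_def, List.flatMap_assoc]
      rw [hfr, letterAt, show q + 2 - 1 = q + 1 by omega, List.getD_cons_succ,
        List.getD_append _ _ _ _ (by simpa using hq), List.getD_eq_getElem _ _ (by simpa using hq),
        List.getElem_map]
      rfl
    rw [this]
    exact WithTop.coe_lt_coe.2 (WithTop.coe_lt_top _)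
  have htop : ((⊤ : WithTop α) : WithTop (WithTop α)) < ⊤ := WithTop.coe_lt_top _
  rw [hlen]
  refine ⟨by omega, fun p hp hpn => ?_, fun p hp hpn => ?_⟩
  · rw [h1]
    rcases Nat.eq_or_lt_of_le hpn with rfl | h
    · rw [hn]; exact htop
    · exact (hlt p hp h).trans htop
  · rw [hn]; exact hlt p hp hpn

end InvLyndon

theorem theorem1 :
    ∃ C : ℕ, ∀ (α : Type*) [LinearOrder α] (w : List α)
      (x : List (WithTop (WithTop α))) (n : ℕ),
      x = frame w → n = x.length →
      ∃ M : Machine (WithTop (WithTop α)),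
        M.text = x ∧ M.cells Reg Arr ≤ C * n ∧ M.maxWord ≤ C * n ∧
        ∀ σ₀ : State Reg Arr, σ₀.reg .n = n →
          ∃ (t : ℕ) (σ : State Reg Arr), Exec M lceNGS σ₀ t σ ∧ t ≤ C * n ∧
            ∀ i : ℕ, 1 ≤ i → i ≤ n →
              σ.arr .next i = nextGreater x i ∧
              σ.arr .prev i = prevGreater x i ∧
              σ.arr .nlce i = lce x i (nextGreater x i) ∧
              σ.arr .plce i = lce x (prevGreater x i) i ∧
              σ.arr .lam i = invLyndonArray x i ∧
              invLyndonArray x i = σ.arr .next i - i + σ.arr .nlce i := by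
  -- The three phases take at most 40 + 212 n + (20 n + 10) units, and n ≥ 2.
  refine ⟨300, ?_⟩
  intro α _ w x n hx hn
  have hf : Framed (letterAt ⊤ x) n := by
    subst hn hx
    exact framed_frame w
  have hn2 := hf.two_le
  -- Cells are numbered from 0 and positions from 1, whence n + 1 cells per array; sums r + m with a
  -- copied m stay below 2 n + 1.
  refine ⟨⟨x, n + 1, 2 * n + 1⟩, rfl, ?_, by simp only; omega, fun σ₀ h₀ => ?_⟩
  · have h1 : Fintype.card Reg = 8 := rfl
    have h2 : Fintype.card Arr = 5 := rfl
    simp only [Machine.cells, h1, h2]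
    omega
  have hM : Fits (⟨x, n + 1, 2 * n + 1⟩ : Machine (WithTop (WithTop α))) (letterAt ⊤ x) n := by
    refine ⟨rfl, rfl, fun p hp hpn => ?_⟩
    have h : p - 1 < x.length := by omega
    simp [Machine.letter, show p ≠ 0 by omega, letterAt, h]
  obtain ⟨t, σ, hexec, hbd, hst, hlam, ht⟩ := lceNGS_runs hM hf h₀
  refine ⟨t, σ, hexec, ht, fun i hi hin => ?_⟩
  have hleft : σ.arr .prev i = prevGreater x i ∧ σ.arr .plce i = lce x (prevGreater x i) i := by
    rcases Nat.eq_or_lt_of_le hi with rfl | h1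
    · rw [prevGreater_one, lce_zero_left]
      exact ⟨hbd.prev_one, hbd.plce_one⟩
    · have he := hst.prev i h1 (by omega)
      have hb := MismatchAt.bounds hf hi he.1 hin (by have := he.2.1; omega) he.2.1.ne'
        (Or.inl he.2.2.1)
      subst hn
      rw [prevGreater_eq_of_prevEdge hf hin he]
      exact ⟨rfl, (lce_eq_of_mismatchAt he.1 hi hb.2 hb.1 (Or.inr he.2.2.1)).symm⟩
  have hright : σ.arr .next i = nextGreater x i ∧ σ.arr .nlce i = lce x i (nextGreater x i) ∧
      invLyndonArray x i = σ.arr .next i - i + σ.arr .nlce i := by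
    -- This serves positions 1 and n: no later suffix is greater, and the LCE with the empty suffix
    -- at n + 1 is 0.
    have hlast : (∀ j, i < j → j ≤ n → Less (letterAt ⊤ x) j i) → σ.arr .next i = n + 1 →
        σ.arr .nlce i = 0 → σ.arr .next i = nextGreater x i ∧
        σ.arr .nlce i = lce x i (nextGreater x i) ∧
        invLyndonArray x i = σ.arr .next i - i + σ.arr .nlce i := fun h h2 h3 => by
      subst hn
      rw [nextGreater_eq_of_forall hf hi h, lce_length_succ, h2, h3]
      exact ⟨rfl, rfl, invLyndonArray_eq (d := ⊤) hi (by omega) (fun j h4 h5 => h j h4 (by omega))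
        (Or.inr ⟨rfl, rfl⟩)⟩
    rcases Nat.eq_or_lt_of_le hi with rfl | h1
    · exact hlast (fun j => hf.less_first) hbd.next_one hbd.nlce_one
    · rcases Nat.eq_or_lt_of_le hin with rfl | h2
      · exact hlast (fun j _ _ => by omega) hbd.next_last hbd.nlce_last
      · obtain ⟨k, e, hk, he⟩ := hf.exists_nextEdge h1 h2
        have hk1 : 1 ≤ k := hi.trans he.1.le
        have hb := MismatchAt.bounds hf hi hk1 hin hk he.1.ne (Or.inl he.2.1)
        obtain ⟨h3, h4⟩ := hst.next i k e hi (by omega) he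
        subst hn
        rw [nextGreater_eq_of_nextEdge hf hi hk he, h3, h4]
        exact ⟨rfl, (lce_eq_of_mismatchAt hi hk1 hb.1 hb.2 (Or.inl he.2.1)).symm,
          invLyndonArray_eq hi he.1 he.2.2 (Or.inl ⟨he.2.1, hb.2⟩)⟩
  exact ⟨hright.1, hleft.1, hright.2.1, hleft.2, (hlam i hi hin).trans hright.2.2.symm,
    hright.2.2⟩
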